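/- Let $d\ge 1$, $\gamma>0$, and let $\{\xi(z):z\in\mathbb Z^d\}$ be independent random variables with the Weibull distribution with parameter $\gamma$, that is, $\mathbb P\{\xi(z)<x\}=1-e^{-x^\gamma}$ for $x\ge 0$. Write $|x|$ for the $\ell^1$-norm of $x\in\mathbb R^d$. For large $t$ let $$\Psi_t(z)=\xi(z)-\frac{|z|}{\gamma t}\log\log t,\qquad z\in\mathbb Z^d .$$ Almost surely, $\Psi_t$ attains its maximum over $\mathbb Z^d$ for all sufficiently large $t$. Let $Z^{(1)}_t$ be a point at which it is attained (any choice in case of ties, and an arbitrary point if the maximum is not attained), and let $$T_t=\inf\{s>0:\ Z^{(1)}_{t+s}\ne Z^{(1)}_t\},\qquad \inf\emptyset=\infty .$$ Then, for all sufficiently large $t$, $T_t<\infty$ almost surely, and, as $t\to\infty$, $T_t/t$ converges weakly to a nondegenerate, almost surely positive real random variable $\Theta$. For every $w\ge 0$, $$\mathbb P\{\Theta\le w\}=1-\int_{\mathbb R^d\times\mathbb R}\exp\{-\nu(D_w(x,y))\}\,\nu(dx,dy),$$ where the integral is finite, $\theta=\gamma^{-1}d^{\,1-1/\gamma}$, $\nu$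 is the measure $\nu(dx,dy)=dx\otimes\gamma\exp\{-\gamma(y+\theta|x|)\}\,dy$ on $\mathbb R^d\times\mathbb R$, and $$D_w(x,y)=\Big\{(\bar x,\bar y)\in\mathbb R^d\times\mathbb R:\ y+\frac{w\theta|x|}{1+w}\le \bar y+\frac{w\theta|\bar x|}{1+w}\Big\}\cup\big(\mathbb R^d\times[y,\infty)\big).$$ -/

import Mathlib

open MeasureTheory ProbabilityTheory Filter Topology
open scoped ENNReal

noncomputable section

namespace PAM

/-- The `ℓ¹`-norm of a point of the lattice `ℤ^d`. -/
def latticeNorm {d : ℕ} (z : Fin d → ℤ) : ℝ := ∑ i, |(z i : ℝ)|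

/-- The `ℓ¹`-norm of a point of `ℝ^d`. -/
def l1Norm {d : ℕ} (x : Fin d → ℝ) : ℝ := ∑ i, |x i|

/-- The functional `Ψ_t(z) = ξ(z) - (|z| / (γ t)) log log t` of a potential `ξ : ℤ^d → ℝ`
(meaningful for large `t`). -/
def Psi {d : ℕ} (γ : ℝ) (ξ : (Fin d → ℤ) → ℝ) (t : ℝ) (z : Fin d → ℤ) : ℝ :=
  ξ z - latticeNorm z / (γ * t) * Real.log (Real.log t)

/-- `z` is a point of `ℤ^d` at which `Ψ_t` attains its maximum over `ℤ^d`. -/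
def IsMaximiser {d : ℕ} (γ : ℝ) (ξ : (Fin d → ℤ) → ℝ) (t : ℝ) (z : Fin d → ℤ) : Prop :=
  ∀ z' : Fin d → ℤ, Psi γ ξ t z' ≤ Psi γ ξ t z

/-- `T_t = inf {s > 0 : Z_{t+s} ≠ Z_t}` for a trajectory `Z`, with `inf ∅ = ∞`. -/
def relocationTime {V : Type*} (Z : ℝ → V) (t : ℝ) : ℝ≥0∞ :=
  sInf (ENNReal.ofReal '' {s : ℝ | 0 < s ∧ Z (t + s) ≠ Z t})

/-- A family of real random variables on `(Ω, P)` that is i.i.d. with the Weibull distribution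
with parameter `γ`: `P(ξ < x) = 1 - exp(-x^γ)` for all `x ≥ 0`. -/
structure IsIIDWeibull {Ω ι : Type*} [MeasurableSpace Ω] (P : Measure Ω) (γ : ℝ)
    (ξ : ι → Ω → ℝ) : Prop where
  measurable : ∀ z, Measurable (ξ z)
  indep : iIndepFun ξ P
  law : ∀ z, ∀ x : ℝ, 0 ≤ x → P.real {ω | ξ z ω < x} = 1 - Real.exp (-x ^ γ)

/-- The constant `θ = γ⁻¹ d^{1 - 1/γ}`. -/
def theta (d : ℕ) (γ : ℝ) : ℝ := γ⁻¹ * (d : ℝ) ^ (1 - 1 / γ)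

/-- The measure `ν(dx, dy) = dx ⊗ γ exp{-γ (y + θ |x|)} dy` on `ℝ^d × ℝ`. -/
def nu (d : ℕ) (γ : ℝ) : Measure ((Fin d → ℝ) × ℝ) :=
  (volume : Measure ((Fin d → ℝ) × ℝ)).withDensity fun p =>
    ENNReal.ofReal (γ * Real.exp (-γ * (p.2 + theta d γ * l1Norm p.1)))

/-- The region
`D_w(x, y) = {(x', y') : y + wθ|x|/(1+w) ≤ y' + wθ|x'|/(1+w)} ∪ (ℝ^d × [y, ∞))`. -/
def D (d : ℕ) (γ w : ℝ) (x : Fin d → ℝ) (y : ℝ) : Set ((Fin d → ℝ) × ℝ) :=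
  {q | y + w * theta d γ * l1Norm x / (1 + w) ≤ q.2 + w * theta d γ * l1Norm q.1 / (1 + w)}
    ∪ Set.univ ×ˢ Set.Ici y

/-- The integral `∫ exp{-ν(D_w(x, y))} ν(dx, dy)` over `ℝ^d × ℝ`, as an element of `[0, ∞]`. -/
def ageingIntegral (d : ℕ) (γ w : ℝ) : ℝ≥0∞ :=
  ∫⁻ p, EReal.exp (-((nu d γ (D d γ w p.1 p.2) : ℝ≥0∞) : EReal)) ∂(nu d γ)

end PAM

end

/-! Write `Ψ_t(z) = ξ(z) - g(t)|z|` with slope `g(t) = log log t / (γ t)`. Past `e^e` the slope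
decreases, and the lead that one site needs over another is linear in the slope. So a site that
beats all others at times `t` and `t + s` also beats them at all times in between. Up to ties, which
have probability zero, and the boundary case `T_t = s`, the event `T_t > s` is therefore the event
`stays` that a single site wins for both slopes `g(t)` and `g(t + s)` (`ae_stays_iff`).

The winning events of different sites are disjoint, and conditioning on `ξ(z)` turns each
probability into an integral of the infinite product `winProb`. Take `r = t (log t)^{1/γ-1} / log
log t` and `A = d log r`, and write the standard exponential variable `ξ(z)^γ` as `A + γ h`. The
factor `e^{-A} = r^{-d}` cancels the number of sites per unit of rescaled volume, so the probability
is exactly the integral of `winDensity` (`measure_stays`). For `s = w t` the rescaled slopes tend to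
`θ` and `θ / (1 + w)`, the rescaled tails become exponential, and a product of many factors close to
one tends to the exponential of minus a rate, as in a Poisson limit (`Scaling.tendsto_winProb`).

Passing to the limit under the integral needs no tail estimates in `(x, h)`. With both slopes equal
to `g(t)` the density is larger and has integral one, because almost surely there is a unique
maximiser; its pointwise limit also has integral one (`stayProb_one`). Hence no mass escapes, and
`tendsto_lintegral_of_le_of_tendsto` applies. The limit `stayProb` at `κ = 1 / (1 + w)` is the
ageing integral after the substitution `y = h - θ|x|`. It is continuous in `w`, equals one at `w =
0` and tends to zero as `w → ∞`, so one minus it is the continuous distribution function of a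
positive nondegenerate variable. -/

namespace PAM

/-! ### Dominated convergence with a varying bound -/

/-- A generalised dominated convergence theorem: if `f ≤ g` pointwise, both converge, and the
integrals of `g` converge to the integral of its limit, then so do the integrals of `f`. -/
theorem tendsto_lintegral_of_le_of_tendsto {α ι : Type*} [MeasurableSpace α] {μ : Measure α}
    {l : Filter ι} [l.IsCountablyGenerated] {f g : ι → α → ℝ≥0∞} {f₀ g₀ : α → ℝ≥0∞}
    (hf : ∀ i, Measurable (f i)) (hg : ∀ i, Measurable (g i)) (hf₀ : Measurable f₀)
    (hfg : ∀ i x, f i x ≤ g i x)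
    (hflim : ∀ x, Tendsto (fun i => f i x) l (𝓝 (f₀ x)))
    (hglim : ∀ x, Tendsto (fun i => g i x) l (𝓝 (g₀ x)))
    (hfin : ∫⁻ x, g₀ x ∂μ ≠ ∞)
    (hint : Tendsto (fun i => ∫⁻ x, g i x ∂μ) l (𝓝 (∫⁻ x, g₀ x ∂μ))) :
    Tendsto (fun i => ∫⁻ x, f i x ∂μ) l (𝓝 (∫⁻ x, f₀ x ∂μ)) := by
  rcases l.eq_or_neBot with rfl | hl
  · simp
  have hle : ∀ x, f₀ x ≤ g₀ x := fun x =>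
    le_of_tendsto_of_tendsto' (hflim x) (hglim x) fun i => hfg i x
  have hf₀fin : ∫⁻ x, f₀ x ∂μ ≠ ∞ := ne_top_of_le_ne_top hfin (lintegral_mono hle)
  have hlow : ∫⁻ x, f₀ x ∂μ ≤ liminf (fun i => ∫⁻ x, f i x ∂μ) l := by
    refine le_trans (lintegral_mono fun x => ?_) (lintegral_liminf_le hf)
    exact (hflim x).liminf_eq.ge
  refine tendsto_of_le_liminf_of_limsup_le hlow ?_
  -- The upper bound comes from Fatou's lemma for the nonnegative functions `g i - f i`. What
  -- remains is to cancel the integral of the difference in `[0, ∞]`.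
  have hadd : ∫⁻ x, (g₀ x - f₀ x) ∂μ ≤ liminf (fun i => ∫⁻ x, (g i x - f i x) ∂μ) l := by
    refine le_trans (lintegral_mono_ae ?_) (lintegral_liminf_le fun i => (hg i).sub (hf i))
    have hae : ∀ᵐ x ∂μ, f₀ x < ∞ := ae_lt_top hf₀ hf₀fin
    filter_upwards [hae] with x hx
    exact (ENNReal.Tendsto.sub (hglim x) (hflim x) (Or.inr hx.ne)).liminf_eq.ge
  have hsplit : ∀ i, (∫⁻ x, f i x ∂μ) + ∫⁻ x, (g i x - f i x) ∂μ = ∫⁻ x, g i x ∂μ := fun i => by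
    rw [← lintegral_add_left (hf i)]
    exact lintegral_congr fun x => add_tsub_cancel_of_le (hfg i x)
  have hsplit₀ : (∫⁻ x, f₀ x ∂μ) + ∫⁻ x, (g₀ x - f₀ x) ∂μ = ∫⁻ x, g₀ x ∂μ := by
    rw [← lintegral_add_left hf₀]
    exact lintegral_congr fun x => add_tsub_cancel_of_le (hle x)
  set c := ∫⁻ x, (g₀ x - f₀ x) ∂μ with hc
  have hcfin : c ≠ ∞ := ne_top_of_le_ne_top hfin (hsplit₀ ▸ le_add_self)
  refine le_of_forall_gt fun b hb => ?_
  obtain ⟨b', hb1, hb2⟩ := exists_between hb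
  refine lt_of_le_of_lt ?_ hb2
  refine limsup_le_of_le (by isBoundedDefault) ?_
  -- If `c = 0` there is no room below `c` for a strict inequality `c - e < c`; then `f₀` and `g₀`
  -- have the same integral and `g` alone bounds `f`.
  rcases eq_or_ne c 0 with hc0 | hc0
  · rw [hc0, add_zero] at hsplit₀
    rw [hsplit₀] at hb1
    filter_upwards [hint.eventually_lt_const hb1] with i hi
    exact (lintegral_mono (hfg i)).trans hi.le
  obtain ⟨b'', hb3, hb4⟩ := exists_between hb1
  -- The minimum with `c` keeps the truncated subtraction honest: `e + (c - e) = c`.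
  set e := min (b' - b'') c with he
  have hepos : 0 < e := lt_min (tsub_pos_of_lt hb4) (pos_iff_ne_zero.2 hc0)
  have h1 : ∀ᶠ i in l, c - e < ∫⁻ x, (g i x - f i x) ∂μ :=
    eventually_lt_of_lt_liminf (lt_of_lt_of_le
      (ENNReal.sub_lt_self hcfin hc0 hepos.ne') hadd)
  have h2 : ∀ᶠ i in l, ∫⁻ x, g i x ∂μ < b'' + c := by
    refine hint.eventually_lt_const ?_
    rw [← hsplit₀]
    exact (ENNReal.add_lt_add_iff_right hcfin).2 hb3
  filter_upwards [h1, h2] with i hi1 hi2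
  rw [← hsplit i] at hi2
  have h3 : (∫⁻ x, f i x ∂μ) + (c - e) ≤ b'' + c := le_trans (by gcongr) hi2.le
  have h4 : (∫⁻ x, f i x ∂μ) + (c - e) ≤ (b'' + e) + (c - e) := by
    rw [add_assoc, add_tsub_cancel_of_le (min_le_right _ _)]
    exact h3
  have h5 := (ENNReal.add_le_add_iff_right (ENNReal.sub_ne_top hcfin)).1 h4
  refine h5.trans ?_
  calc b'' + e ≤ b'' + (b' - b'') := by gcongr; exact min_le_left _ _
    _ = b' := add_tsub_cancel_of_le hb4.le

/-! ### Lattice sums as integrals over rescaled space -/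

/-- The lattice point below `r x`. -/
noncomputable def latticePoint {d : ℕ} (r : ℝ) (x : Fin d → ℝ) : Fin d → ℤ := fun i => ⌊r * x i⌋

theorem measurable_latticePoint {d : ℕ} (r : ℝ) :
    Measurable (latticePoint r : (Fin d → ℝ) → Fin d → ℤ) :=
  measurable_pi_lambda _ fun i => Int.measurable_floor.comp (by fun_prop)

theorem map_latticePoint_one (d : ℕ) :
    (volume : Measure (Fin d → ℝ)).map (latticePoint 1) = Measure.count := by
  refine Measure.ext_of_singleton fun z => ?_
  rw [Measure.map_apply (measurable_latticePoint 1) (measurableSet_singleton z),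
    Measure.count_singleton]
  have : (latticePoint 1 : (Fin d → ℝ) → _) ⁻¹' {z} =
      Set.univ.pi fun i => Set.Ico (z i : ℝ) (z i + 1) := by
    ext x
    simp [latticePoint, funext_iff, Int.floor_eq_iff]
  rw [this, Real.volume_pi_Ico]
  simp

/-- The integrand is constant on cells of volume `r^{-d}`, so the identity is exact. Sums over the
lattice at different scales thus become integrals over one fixed space, where convergence theorems
apply. -/
theorem tsum_eq_lintegral_latticePoint {d : ℕ} {r : ℝ} (hr : 0 < r) (F : (Fin d → ℤ) → ℝ≥0∞) :
    ∑' z, F z = ENNReal.ofReal (r ^ d) * ∫⁻ x : Fin d → ℝ, F (latticePoint r x) := by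
  have hF : Measurable F := measurable_of_countable F
  rw [← lintegral_count, ← map_latticePoint_one, lintegral_map hF (measurable_latticePoint 1)]
  have h := Measure.map_addHaar_smul (volume : Measure (Fin d → ℝ)) hr.ne'
  have h2 : ∫⁻ x : Fin d → ℝ, F (latticePoint r x) =
      ∫⁻ x, F (latticePoint 1 x) ∂((volume : Measure (Fin d → ℝ)).map (r • ·)) := by
    rw [lintegral_map (f := fun x => F (latticePoint 1 x))
      (hF.comp (measurable_latticePoint 1)) (by fun_prop)]
    refine lintegral_congr fun x => ?_
    congr 1
    funext i
    simp [latticePoint]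
  rw [h2, h, lintegral_smul_measure, smul_eq_mul, ← mul_assoc, ← ENNReal.ofReal_mul (by positivity)]
  have : r ^ d * |(r ^ Module.finrank ℝ (Fin d → ℝ))⁻¹| = 1 := by
    rw [Module.finrank_fin_fun, abs_of_pos (by positivity)]
    exact mul_inv_cancel₀ (by positivity)
  rw [this, ENNReal.ofReal_one, one_mul]

theorem l1Norm_nonneg {d : ℕ} (x : Fin d → ℝ) : 0 ≤ l1Norm x :=
  Finset.sum_nonneg fun _ _ => abs_nonneg _

theorem latticeNorm_nonneg {d : ℕ} (x : Fin d → ℤ) : 0 ≤ latticeNorm x :=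
  Finset.sum_nonneg fun _ _ => abs_nonneg _

theorem continuous_l1Norm {d : ℕ} : Continuous (l1Norm : (Fin d → ℝ) → ℝ) := by
  unfold l1Norm
  fun_prop

theorem norm_le_l1Norm {d : ℕ} (x : Fin d → ℝ) : ‖x‖ ≤ l1Norm x :=
  (pi_norm_le_iff_of_nonneg (l1Norm_nonneg x)).2 fun i =>
    Finset.single_le_sum (f := fun i => |x i|) (fun _ _ => abs_nonneg _) (Finset.mem_univ i)

theorem abs_latticeNorm_latticePoint_sub_le {d : ℕ} {r : ℝ} (hr : 0 < r) (x : Fin d → ℝ) :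
    |latticeNorm (latticePoint r x) / r - l1Norm x| ≤ d / r := by
  rw [latticeNorm, l1Norm, Finset.sum_div, ← Finset.sum_sub_distrib]
  refine (Finset.abs_sum_le_sum_abs _ _).trans ?_
  have : ∀ i ∈ (Finset.univ : Finset (Fin d)),
      |(|((latticePoint r x i : ℤ) : ℝ)| / r - |x i|)| ≤ 1 / r := by
    intro i _
    have h1 : |((latticePoint r x i : ℤ) : ℝ)| / r = |((latticePoint r x i : ℤ) : ℝ) / r| := by
      rw [abs_div, abs_of_pos hr]
    rw [h1]
    refine (abs_abs_sub_abs_le_abs_sub _ _).trans ?_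
    have h2 : ((latticePoint r x i : ℤ) : ℝ) / r - x i =
        ((latticePoint r x i : ℤ) - r * x i) / r := by
      field_simp
    rw [h2, abs_div, abs_of_pos hr]
    gcongr
    rw [abs_le]
    have := Int.floor_le (r * x i)
    have := Int.lt_floor_add_one (r * x i)
    simp only [latticePoint]
    constructor <;> linarith
  refine (Finset.sum_le_sum this).trans ?_
  simp [div_eq_mul_inv]

theorem tendsto_latticeNorm_latticePoint {d : ℕ} {ι : Type*} {l : Filter ι} {r : ι → ℝ}
    (hr : Tendsto r l atTop) (x : Fin d → ℝ) :
    Tendsto (fun i => latticeNorm (latticePoint (r i) x) / r i) l (𝓝 (l1Norm x)) := by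
  rw [tendsto_iff_dist_tendsto_zero]
  refine squeeze_zero' (Eventually.of_forall fun _ => dist_nonneg) ?_
    ((tendsto_const_nhds (x := (d : ℝ))).div_atTop hr)
  filter_upwards [hr.eventually_gt_atTop 0] with i hi
  exact abs_latticeNorm_latticePoint_sub_le hi x

/-! ### The rescaled Weibull tail -/

/-- The tail function `x ↦ P(ξ ≥ x)` of the Weibull distribution. -/
noncomputable def tail (γ x : ℝ) : ℝ := Real.exp (-(max x 0) ^ γ)

/-- The exponent that governs the rescaled Weibull tail, see `tail_rescaled`. -/
noncomputable def excess (γ A s : ℝ) : ℝ := A * ((max (1 + s / A) 0) ^ γ - 1)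

/-- The height above the level `A ^ (1 / γ)`, in units of `A ^ (1 / γ - 1)`. -/
noncomputable def level (γ A s : ℝ) : ℝ := A ^ (1 / γ) + A ^ (1 / γ - 1) * s

theorem tail_pos (γ x : ℝ) : 0 < tail γ x := Real.exp_pos _

theorem tail_le_one (γ x : ℝ) : tail γ x ≤ 1 := by
  rw [tail, Real.exp_le_one_iff]
  have := Real.rpow_nonneg (le_max_right x 0) γ
  linarith

theorem tail_antitone {γ : ℝ} (hγ : 0 < γ) : Antitone (tail γ) := fun x y h => by
  unfold tail
  gcongr

theorem continuous_tail {γ : ℝ} (hγ : 0 < γ) : Continuous (tail γ) := by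
  unfold tail
  have : Continuous fun x : ℝ => (max x 0) ^ γ :=
    (continuous_id.max continuous_const).rpow_const fun _ => Or.inr hγ.le
  fun_prop

theorem level_eq {γ A : ℝ} (hA : 0 < A) (s : ℝ) : level γ A s = A ^ (1 / γ) * (1 + s / A) := by
  rw [level, Real.rpow_sub_one hA.ne']
  ring

/-- The tail equals `e^{-A}` at the level `A^{1/γ}`. For `A = d log r` this is `r^{-d}`, the scale
on which about one site per unit of rescaled volume exceeds the level. -/
theorem tail_level {γ A : ℝ} (hγ : 0 < γ) (hA : 0 < A) (s : ℝ) :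
    tail γ (level γ A s) = Real.exp (-A) * Real.exp (-excess γ A s) := by
  have ha : 0 ≤ A ^ (1 / γ) := by positivity
  have h : max (A ^ (1 / γ) * (1 + s / A)) 0 = A ^ (1 / γ) * max (1 + s / A) 0 := by
    rw [mul_max_of_nonneg _ _ ha, mul_zero]
  rw [tail, level_eq hA, h, Real.mul_rpow ha (le_max_right _ _), ← Real.rpow_mul hA.le,
    one_div_mul_cancel hγ.ne', Real.rpow_one, ← Real.exp_add, excess]
  congr 1
  ring

theorem excess_mono {γ A : ℝ} (hγ : 0 < γ) (hA : 0 < A) : Monotone (excess γ A) := fun s s' h => by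
  unfold excess
  gcongr

/-- The excess is `A` times the increment of `x ↦ x^γ` from `1` to `1 + s / A`, so the derivative
`γ` at `1` gives the limit. The truncation at zero is eventually inactive. -/
theorem tendsto_excess {γ : ℝ} {ι : Type*} {l : Filter ι} {A s : ι → ℝ} {s₀ : ℝ}
    (hA : Tendsto A l atTop) (hs : Tendsto s l (𝓝 s₀)) :
    Tendsto (fun i => excess γ (A i) (s i)) l (𝓝 (γ * s₀)) := by
  have hdiv : Tendsto (fun i => s i / A i) l (𝓝 0) := hs.div_atTop hA
  have hd : HasDerivAt (fun x : ℝ => x ^ γ) γ 1 := by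
    simpa using Real.hasDerivAt_rpow_const (x := 1) (p := γ) (Or.inl one_ne_zero)
  have hcd : Tendsto (fun i => A i • (s i / A i)) l (𝓝 s₀) := by
    refine hs.congr' ?_
    filter_upwards [hA.eventually_gt_atTop 0] with i hi
    rw [smul_eq_mul, mul_div_cancel₀ _ hi.ne']
  have h := (hasFDerivWithinAt_univ.2 hd.hasFDerivAt).lim hdiv
    (Eventually.of_forall fun _ => Set.mem_univ _) hcd
  have h2 : Tendsto (fun i => A i • ((1 + s i / A i) ^ γ - 1 ^ γ)) l (𝓝 (γ * s₀)) := by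
    simpa [mul_comm] using h
  refine h2.congr' ?_
  have hpos : ∀ᶠ i in l, 0 < 1 + s i / A i := by
    have : Tendsto (fun i => 1 + s i / A i) l (𝓝 (1 + 0)) := tendsto_const_nhds.add hdiv
    rw [add_zero] at this
    exact this.eventually_const_lt one_pos
  filter_upwards [hpos] with i hi
  rw [excess, max_eq_left hi.le, smul_eq_mul, Real.one_rpow]

/-- The bound is free of `A`, so that one integrable function serves all large scales. Lowering the
exponent to `min γ 1` makes the power concave, at the price of a stretched exponential. -/
theorem le_excess {γ A s : ℝ} (hγ : 0 < γ) (hA : 1 ≤ A) (hs : 0 ≤ s) :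
    (1 + s) ^ (min γ 1) - 1 ≤ excess γ A s := by
  have hA0 : 0 < A := by linarith
  have hβ0 : 0 < min γ 1 := lt_min hγ one_pos
  have hx : 0 ≤ s / A := by positivity
  have h1 : (1 + s / A) ^ (min γ 1) ≤ (1 + s / A) ^ γ :=
    Real.rpow_le_rpow_of_exponent_le (by linarith) (min_le_left _ _)
  -- concavity of the power function along the segment from `1` to `1 + s`
  have hconc := (Real.concaveOn_rpow hβ0.le (min_le_right γ 1)).2
    (show (1 : ℝ) ∈ Set.Ici 0 by simp) (show 1 + s ∈ Set.Ici 0 by simp; linarith)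
    (show 0 ≤ 1 - 1 / A by rw [sub_nonneg, div_le_one hA0]; exact hA)
    (show 0 ≤ 1 / A by positivity) (by ring)
  simp only [smul_eq_mul, Real.one_rpow, mul_one] at hconc
  have h2 : 1 - 1 / A + 1 / A * (1 + s) = 1 + s / A := by ring
  rw [h2] at hconc
  have h3 : A * (1 - 1 / A + 1 / A * (1 + s) ^ (min γ 1) - 1) = (1 + s) ^ (min γ 1) - 1 := by
    field_simp
    ring
  rw [excess, max_eq_left (by linarith), ← h3]
  gcongr
  linarith

/-- An integrable bound for the rescaled tail as a function of the rescaled position. -/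
noncomputable def tailBound {d : ℕ} (γ c K : ℝ) (x : Fin d → ℝ) : ℝ :=
  Real.exp (1 - (1 + max (c * l1Norm x - K) 0) ^ (min γ 1))

theorem exp_neg_excess_le {d : ℕ} {γ A c K : ℝ} (hγ : 0 < γ) (hA : 1 ≤ A) {M s : ℝ} (hM : 1 ≤ M)
    (x : Fin d → ℝ) (hc : 0 ≤ c) (hAM : Real.exp (-excess γ A (-K)) ≤ M)
    (hs : c * l1Norm x - K ≤ s) :
    Real.exp (-excess γ A s) ≤ M * tailBound γ c K x := by
  have hA0 : 0 < A := by linarith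
  have hmono := excess_mono hγ hA0 hs
  rcases le_total 0 (c * l1Norm x - K) with h | h
  · have := le_excess hγ hA h
    calc Real.exp (-excess γ A s) ≤ tailBound γ c K x := by
          rw [tailBound, max_eq_left h]
          gcongr
          linarith
      _ ≤ M * tailBound γ c K x := le_mul_of_one_le_left (Real.exp_pos _).le hM
  · have : tailBound γ c K x = 1 := by simp [tailBound, max_eq_right h]
    rw [this, mul_one]
    refine le_trans ?_ hAM
    have h2 : -K ≤ c * l1Norm x - K := by
      have := mul_nonneg hc (l1Norm_nonneg x)
      linarith
    have := excess_mono hγ hA0 h2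
    gcongr
    linarith

theorem lintegral_tailBound_lt_top {d : ℕ} {γ c K : ℝ} (hγ : 0 < γ) (hc : 0 < c) :
    ∫⁻ x : Fin d → ℝ, ENNReal.ofReal (tailBound γ c K x) < ∞ := by
  set β := min γ 1 with hβ
  have hβ0 : 0 < β := lt_min hγ one_pos
  -- the function decays faster than any power of `1 + ‖x‖`
  obtain ⟨C, hC⟩ : ∃ C : ℝ, ∀ y : ℝ, 0 ≤ y →
      Real.exp (1 - (1 + max (c * y - K) 0) ^ β) ≤ C * (1 + y) ^ (-((d : ℝ) + 1)) := by
    have hlim : Tendsto (fun y : ℝ => Real.exp (1 - (1 + max (c * y - K) 0) ^ β) *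
        (1 + y) ^ ((d : ℝ) + 1)) atTop (𝓝 0) := by
      have hu : Tendsto (fun y : ℝ => (1 + (c * y - K))) atTop atTop := by
        refine tendsto_atTop_add_const_left _ _ ?_
        simpa [sub_eq_add_neg] using
          tendsto_atTop_add_const_right _ (-K) (tendsto_id.const_mul_atTop hc)
      -- With `u = 1 + (c y - K)` and `v = u ^ β`, the product `u ^ (d + 1) * exp (-u ^ β)` is `v ^
      -- ((d + 1) / β) * exp (-v)`; the ratio of `1 + y` to `u` stays bounded.
      have h1 := (tendsto_rpow_mul_exp_neg_mul_atTop_nhds_zero (((d : ℝ) + 1) / β) 1 one_pos).comp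
        ((tendsto_rpow_atTop hβ0).comp hu)
      have h2 : Tendsto (fun y : ℝ => ((1 + y) / (1 + (c * y - K))) ^ ((d : ℝ) + 1)) atTop
          (𝓝 ((1 / c) ^ ((d : ℝ) + 1))) := by
        refine Tendsto.rpow_const ?_ (Or.inl (by positivity))
        have h3 : Tendsto (fun y : ℝ => 1 / c + (1 - (1 - K) / c) / (1 + (c * y - K))) atTop
            (𝓝 (1 / c + 0)) := tendsto_const_nhds.add (tendsto_const_nhds.div_atTop hu)
        rw [add_zero] at h3
        refine h3.congr' ?_
        filter_upwards [hu.eventually_gt_atTop 0] with y hy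
        field_simp
        ring
      have h4 := ((h1.mul h2).const_mul (Real.exp 1))
      rw [zero_mul, mul_zero] at h4
      refine h4.congr' ?_
      filter_upwards [hu.eventually_gt_atTop 1, eventually_gt_atTop 0] with y hy hy0
      have hpos : 0 < 1 + (c * y - K) := by linarith
      simp only [Function.comp]
      rw [max_eq_left (by linarith), Real.div_rpow (by positivity) hpos.le, ← Real.rpow_mul hpos.le,
        mul_div_cancel₀ _ hβ0.ne', sub_eq_add_neg 1 ((1 + (c * y - K)) ^ β), Real.exp_add,
        neg_one_mul]
      have : (1 + (c * y - K)) ^ ((d : ℝ) + 1) ≠ 0 := by positivity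
      field_simp
    obtain ⟨Y, hY⟩ := (hlim.eventually_le_const one_pos).exists_forall_of_atTop
    refine ⟨max 1 ((1 + max Y 0) ^ ((d : ℝ) + 1)), fun y hy => ?_⟩
    have hp : 0 < (1 + y) ^ ((d : ℝ) + 1) := by positivity
    rw [Real.rpow_neg (by linarith), ← div_eq_mul_inv, le_div_iff₀ hp]
    rcases le_total Y y with h | h
    · exact (hY y h).trans (le_max_left _ _)
    · refine le_trans ?_ (le_max_right _ _)
      have h5 : Real.exp (1 - (1 + max (c * y - K) 0) ^ β) ≤ 1 := by
        rw [Real.exp_le_one_iff, sub_nonpos]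
        exact Real.one_le_rpow (by simp) hβ0.le
      calc _ ≤ 1 * (1 + y) ^ ((d : ℝ) + 1) := by gcongr
        _ ≤ _ := by
          rw [one_mul]
          gcongr
          exact h.trans (le_max_left _ _)
  have hC0 : 0 ≤ C := by
    have := (Real.exp_pos _).le.trans (hC 0 le_rfl)
    simpa using this
  have hfin := (integrable_one_add_norm (E := Fin d → ℝ) (μ := volume) (r := (d : ℝ) + 1)
    (by simp)).const_mul C
  refine lt_of_le_of_lt (lintegral_mono fun x => ?_) hfin.lintegral_lt_top
  refine ENNReal.ofReal_le_ofReal ((hC _ (l1Norm_nonneg x)).trans ?_)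
  refine mul_le_mul_of_nonneg_left ?_ hC0
  refine Real.rpow_le_rpow_of_nonpos (by positivity) ?_ (by linarith [(Nat.cast_nonneg d : (0:ℝ) ≤ d)])
  linarith [norm_le_l1Norm x]

/-! ### Convergence of the probability that a given site wins -/

theorem theta_pos {d : ℕ} (hd : 0 < d) {γ : ℝ} (hγ : 0 < γ) : 0 < theta d γ := by
  unfold theta
  positivity

/-- The product of `1 - p` over a countable family of small numbers, compared with `exp (-∑ p)`. -/
theorem tprod_one_sub_bounds {α : Type*} {p : α → ℝ} {ε : ℝ} (hε : ε < 1) (hp0 : ∀ a, 0 ≤ p a)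
    (hpε : ∀ a, p a ≤ ε) (hp : Summable p) :
    ENNReal.ofReal (Real.exp (-(∑' a, p a) / (1 - ε))) ≤ ∏' a, ENNReal.ofReal (1 - p a) ∧
      ∏' a, ENNReal.ofReal (1 - p a) ≤ ENNReal.ofReal (Real.exp (-∑' a, p a)) := by
  have h1 : ∀ a, ENNReal.ofReal (1 - p a) ≤ 1 := fun a => by
    rw [ENNReal.ofReal_le_one]
    linarith [hp0 a]
  have hfin : ∀ F : Finset α, ∏ a ∈ F, ENNReal.ofReal (1 - p a) =
      ENNReal.ofReal (∏ a ∈ F, (1 - p a)) := fun F =>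
    (ENNReal.ofReal_prod_of_nonneg fun a _ => by linarith [hpε a]).symm
  have hε' : 0 < 1 - ε := by linarith
  rw [ENNReal.tprod_eq_iInf_prod h1]
  constructor
  · refine le_iInf fun F => ?_
    rw [hfin]
    refine ENNReal.ofReal_le_ofReal ?_
    calc Real.exp (-(∑' a, p a) / (1 - ε)) ≤ Real.exp (∑ a ∈ F, -p a / (1 - ε)) := by
          rw [← Finset.sum_div, Finset.sum_neg_distrib]
          gcongr
          exact hp.sum_le_tsum F fun a _ => hp0 a
      _ = ∏ a ∈ F, Real.exp (-p a / (1 - ε)) := Real.exp_sum _ _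
      _ ≤ ∏ a ∈ F, (1 - p a) := by
          refine Finset.prod_le_prod (fun a _ => (Real.exp_pos _).le) fun a _ => ?_
          have hpa : 0 < 1 - p a := by linarith [hpε a]
          -- `log (1 - p) ≥ 1 - 1 / (1 - p) = -p / (1 - p) ≥ -p / (1 - ε)`.
          have hlog := Real.one_sub_inv_le_log_of_pos hpa
          rw [← Real.le_log_iff_exp_le hpa]
          refine le_trans ?_ hlog
          have : 1 - (1 - p a)⁻¹ = -p a / (1 - p a) := by field_simp; ring
          rw [this, neg_div, neg_div, neg_le_neg_iff]
          exact div_le_div_of_nonneg_left (hp0 a) hε' (by linarith [hpε a])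
  · have hsum : Tendsto (fun F : Finset α => ∑ a ∈ F, p a) atTop (𝓝 (∑' a, p a)) := hp.hasSum
    have hlim : Tendsto (fun F : Finset α => ENNReal.ofReal (Real.exp (-∑ a ∈ F, p a))) atTop
        (𝓝 (ENNReal.ofReal (Real.exp (-∑' a, p a)))) :=
      ENNReal.tendsto_ofReal ((Real.continuous_exp.tendsto _).comp hsum.neg)
    refine ge_of_tendsto' hlim fun F => (iInf_le _ F).trans ?_
    rw [hfin]
    refine ENNReal.ofReal_le_ofReal ?_
    rw [← Finset.sum_neg_distrib, Real.exp_sum]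
    refine Finset.prod_le_prod (fun a _ => by linarith [hpε a]) fun a _ => ?_
    linarith [Real.add_one_le_exp (-p a)]

/-- How much higher than at `z` the potential has to be at `z'` in order that `z'` beats `z`
for one of the slopes `g₀`, `g₁`. -/
noncomputable def gap {d : ℕ} (g₀ g₁ : ℝ) (z z' : Fin d → ℤ) : ℝ :=
  min (g₀ * (latticeNorm z' - latticeNorm z)) (g₁ * (latticeNorm z' - latticeNorm z))

/-- The probability that no other point beats the point `z` of height `u` for one of the slopes
`g₀`, `g₁`. -/
noncomputable def winProb {d : ℕ} (γ g₀ g₁ : ℝ) (z : Fin d → ℤ) (u : ℝ) : ℝ≥0∞ :=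
  ∏' z' : {z' : Fin d → ℤ // z' ≠ z}, ENNReal.ofReal (1 - tail γ (u + gap g₀ g₁ z z'))

/-- The height at which the rescaled potential takes the value `h`. -/
noncomputable def height (γ A h : ℝ) : ℝ := level γ A (excess (1 / γ) A (γ * h))

/-- The intensity of the points that lie, for one of the slopes `θ`, `κ θ`, above a point at
distance `|x|` whose height is `h`. -/
noncomputable def limitRate (d : ℕ) (γ κ : ℝ) (x : Fin d → ℝ) (h : ℝ) : ℝ≥0∞ :=
  ∫⁻ x' : Fin d → ℝ, ENNReal.ofReal (Real.exp (-(γ * (h +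
    min (theta d γ * (l1Norm x' - l1Norm x)) (κ * theta d γ * (l1Norm x' - l1Norm x))))))

/-- The spatial scale `r` and the slopes `g₀`, `g₁` for which the rescaled potential has a
nontrivial limit. -/
structure Scaling (d : ℕ) (γ κ : ℝ) {ι : Type*} (l : Filter ι) (r g₀ g₁ : ι → ℝ) : Prop where
  one_lt_r : ∀ i, 1 < r i
  g₁_pos : ∀ i, 0 < g₁ i
  g₁_le : ∀ i, g₁ i ≤ g₀ i
  tendsto_r : Tendsto r l atTop
  tendsto_g₀ : Tendsto (fun i => g₀ i * r i / (d * Real.log (r i)) ^ (1 / γ - 1)) l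
    (𝓝 (theta d γ))
  tendsto_g₁ : Tendsto (fun i => g₁ i * r i / (d * Real.log (r i)) ^ (1 / γ - 1)) l
    (𝓝 (κ * theta d γ))

section
variable {d : ℕ} {γ κ : ℝ} {ι : Type*} {l : Filter ι} {r g₀ g₁ : ι → ℝ}

/-- Both slopes are compared with the worst choice for each term: the small slope `b` in front of
`q'`, the large slope `a` in front of `q`. The result grows linearly in `q'`. -/
theorem min_mul_ge {a b q q' : ℝ} (hab : b ≤ a) (hq : 0 ≤ q) (hq' : 0 ≤ q') :
    b * q' - a * q ≤ min (a * (q' - q)) (b * (q' - q)) := by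
  refine le_min ?_ ?_ <;> nlinarith

theorem height_add_gap {A r g₀ g₁ : ℝ} (hA : 0 < A) (hr : 0 < r) (h : ℝ) (z z' : Fin d → ℤ) :
    height γ A h + gap g₀ g₁ z z' = level γ A (excess (1 / γ) A (γ * h) +
      min (g₀ * r / A ^ (1 / γ - 1) * (latticeNorm z' / r - latticeNorm z / r))
        (g₁ * r / A ^ (1 / γ - 1) * (latticeNorm z' / r - latticeNorm z / r))) := by
  have hs : 0 < A ^ (1 / γ - 1) := by positivity
  have key : ∀ g : ℝ, A ^ (1 / γ - 1) * (g * r / A ^ (1 / γ - 1) *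
      (latticeNorm z' / r - latticeNorm z / r)) = g * (latticeNorm z' - latticeNorm z) := by
    intro g
    field_simp
  rw [height, level, level, mul_add, mul_min_of_nonneg _ _ hs.le, key, key, gap]
  ring

theorem Scaling.log_pos (H : Scaling d γ κ l r g₀ g₁) (hd : 0 < d) (i : ι) :
    0 < d * Real.log (r i) := by
  have := Real.log_pos (H.one_lt_r i)
  positivity

theorem Scaling.tendsto_log (H : Scaling d γ κ l r g₀ g₁) (hd : 0 < d) :
    Tendsto (fun i => d * Real.log (r i)) l atTop :=
  (Real.tendsto_log_atTop.comp H.tendsto_r).const_mul_atTop (by positivity)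

theorem Scaling.exp_neg_log (H : Scaling d γ κ l r g₀ g₁) (i : ι) :
    Real.exp (-(d * Real.log (r i))) = (r i ^ d)⁻¹ := by
  have hr : 0 < r i := one_pos.trans (H.one_lt_r i)
  rw [← neg_mul, mul_comm, Real.exp_mul, Real.exp_log hr, Real.rpow_neg hr.le, Real.rpow_natCast]

/-- A lower bound for the rescaled height needed in order to beat the point near `x`. -/
theorem Scaling.eventually_lower_bound (H : Scaling d γ κ l r g₀ g₁) (hd : 0 < d) (hγ : 0 < γ)
    (hκ : 0 < κ) (x : Fin d → ℝ) (h : ℝ) :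
    ∃ c K M : ℝ, 0 < c ∧ 1 ≤ M ∧ ∀ᶠ i in l, 1 ≤ d * Real.log (r i) ∧
      Real.exp (-excess γ (d * Real.log (r i)) (-K)) ≤ M ∧
      ∀ q' : ℝ, 0 ≤ q' → c * (q' + d) - K ≤
        excess (1 / γ) (d * Real.log (r i)) (γ * h) +
        min (g₀ i * r i / (d * Real.log (r i)) ^ (1 / γ - 1) *
            (q' - latticeNorm (latticePoint (r i) x) / r i))
          (g₁ i * r i / (d * Real.log (r i)) ^ (1 / γ - 1) *
            (q' - latticeNorm (latticePoint (r i) x) / r i)) := by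
  have hθ := theta_pos hd hγ
  set θ := theta d γ
  -- Half of the limiting smaller slope, so that this slope eventually exceeds `c`. The constant `K`
  -- collects a lower bound `-(|h| + 1)` for the height, the shift `c * d` and the bound `(θ + 1) *
  -- (l1Norm x + d)` for the term with the larger slope.
  set c := κ * θ / 2 with hc
  have hc0 : 0 < c := by positivity
  set K := |h| + 1 + c * d + (θ + 1) * (l1Norm x + d) with hK
  have hA := H.tendsto_log hd
  have hs : Tendsto (fun i => excess (1 / γ) (d * Real.log (r i)) (γ * h)) l (𝓝 h) := by
    have := tendsto_excess (γ := 1 / γ) hA (tendsto_const_nhds (x := γ * h))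
    rwa [show 1 / γ * (γ * h) = h by field_simp] at this
  have hM : Tendsto (fun i => Real.exp (-excess γ (d * Real.log (r i)) (-K))) l
      (𝓝 (Real.exp (-(γ * -K)))) :=
    (Real.continuous_exp.tendsto _).comp (tendsto_excess hA tendsto_const_nhds).neg
  have hKγ : 0 < Real.exp (-(γ * -K)) := Real.exp_pos _
  refine ⟨c, K, Real.exp (-(γ * -K)) + 1, hc0, by linarith, ?_⟩
  have hκθ : c < κ * θ := by rw [hc]; linarith [mul_pos hκ hθ]
  filter_upwards [hA.eventually_ge_atTop 1, hM.eventually_le_const (lt_add_one _),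
    hs.eventually_const_lt (show -(|h| + 1) < h by linarith [neg_abs_le h]),
    H.tendsto_g₀.eventually_lt_const (lt_add_one _), H.tendsto_g₁.eventually_const_lt hκθ]
    with i h1 h2 h3 h4 h5
  refine ⟨h1, h2, fun q' hq' => ?_⟩
  have hr : 0 < r i := one_pos.trans (H.one_lt_r i)
  have hpow : 0 < (d * Real.log (r i)) ^ (1 / γ - 1) := Real.rpow_pos_of_pos (by linarith) _
  set a := g₀ i * r i / (d * Real.log (r i)) ^ (1 / γ - 1)
  set b := g₁ i * r i / (d * Real.log (r i)) ^ (1 / γ - 1)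
  have hba : b ≤ a := by
    simp only [a, b]
    gcongr
    exact H.g₁_le i
  set q := latticeNorm (latticePoint (r i) x) / r i with hq
  have hq0 : 0 ≤ q := div_nonneg (latticeNorm_nonneg _) hr.le
  have hqx : q ≤ l1Norm x + d := by
    have h6 := (abs_le.1 (abs_latticeNorm_latticePoint_sub_le hr x)).2
    have h7 : (d : ℝ) / r i ≤ d := div_le_self (Nat.cast_nonneg d) (H.one_lt_r i).le
    linarith
  have hmin := min_mul_ge hba hq0 hq'
  have h8 : c * q' ≤ b * q' := by gcongr
  have h9 : a * q ≤ (θ + 1) * (l1Norm x + d) := by gcongr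
  have h10 : c * (q' + d) = c * q' + c * d := by ring
  linarith

/-- Each tail carries a factor `r^{-d}`, which turns the sum into an integral of rescaled tails;
these converge pointwise and are dominated by a multiple of `tailBound`. The same lower bound on the
heights makes the supremum of order `r^{-d}`, which is what the passage from product to exponential
requires. -/
theorem Scaling.tendsto_sum_tail (H : Scaling d γ κ l r g₀ g₁) [l.IsCountablyGenerated] [l.NeBot]
    (hd : 0 < d) (hγ : 0 < γ) (hκ : 0 < κ) (x : Fin d → ℝ) (h : ℝ) :
    Tendsto (fun i => ∑' z', ENNReal.ofReal (tail γ (height γ (d * Real.log (r i)) h +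
      gap (g₀ i) (g₁ i) (latticePoint (r i) x) z'))) l (𝓝 (limitRate d γ κ x h)) ∧
    limitRate d γ κ x h ≠ ∞ ∧
    Tendsto (fun i => ⨆ z', tail γ (height γ (d * Real.log (r i)) h +
      gap (g₀ i) (g₁ i) (latticePoint (r i) x) z')) l (𝓝 0) := by
  obtain ⟨c, K, M, hc, hM, hev⟩ := H.eventually_lower_bound hd hγ hκ x h
  have hA := H.tendsto_log hd
  have hs : Tendsto (fun i => excess (1 / γ) (d * Real.log (r i)) (γ * h)) l (𝓝 h) := by
    have := tendsto_excess (γ := 1 / γ) hA (tendsto_const_nhds (x := γ * h))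
    rwa [show 1 / γ * (γ * h) = h by field_simp] at this
  -- the rescaled height
  let pos : ι → (Fin d → ℤ) → ℝ := fun i z' => excess (1 / γ) (d * Real.log (r i)) (γ * h) +
    min (g₀ i * r i / (d * Real.log (r i)) ^ (1 / γ - 1) *
        (latticeNorm z' / r i - latticeNorm (latticePoint (r i) x) / r i))
      (g₁ i * r i / (d * Real.log (r i)) ^ (1 / γ - 1) *
        (latticeNorm z' / r i - latticeNorm (latticePoint (r i) x) / r i))
  have htail : ∀ i z', tail γ (height γ (d * Real.log (r i)) h +
      gap (g₀ i) (g₁ i) (latticePoint (r i) x) z') =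
      (r i ^ d)⁻¹ * Real.exp (-excess γ (d * Real.log (r i)) (pos i z')) := fun i z' => by
    rw [height_add_gap (H.log_pos hd i) (one_pos.trans (H.one_lt_r i)),
      tail_level hγ (H.log_pos hd i), H.exp_neg_log]
  have hbound : ∀ᶠ i in l, ∀ x' : Fin d → ℝ,
      Real.exp (-excess γ (d * Real.log (r i)) (pos i (latticePoint (r i) x'))) ≤
        M * tailBound γ c K x' := by
    filter_upwards [hev] with i ⟨hi1, hi2, hi3⟩ x'
    refine exp_neg_excess_le hγ hi1 hM x' hc.le hi2 ?_
    have hr : 0 < r i := one_pos.trans (H.one_lt_r i)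
    refine le_trans ?_ (hi3 _ (div_nonneg (latticeNorm_nonneg (latticePoint (r i) x')) hr.le))
    have h6 := (abs_le.1 (abs_latticeNorm_latticePoint_sub_le hr x')).1
    have h7 : (d : ℝ) / r i ≤ d := div_le_self (Nat.cast_nonneg d) (H.one_lt_r i).le
    gcongr
    linarith
  have hpoint : ∀ x' : Fin d → ℝ, Tendsto
      (fun i => Real.exp (-excess γ (d * Real.log (r i)) (pos i (latticePoint (r i) x')))) l
      (𝓝 (Real.exp (-(γ * (h + min (theta d γ * (l1Norm x' - l1Norm x))
        (κ * theta d γ * (l1Norm x' - l1Norm x))))))) := fun x' => by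
    have hq := (tendsto_latticeNorm_latticePoint H.tendsto_r x').sub
      (tendsto_latticeNorm_latticePoint H.tendsto_r x)
    have hpos := hs.add ((H.tendsto_g₀.mul hq).min (H.tendsto_g₁.mul hq))
    exact (Real.continuous_exp.tendsto _).comp (tendsto_excess hA hpos).neg
  have hdom : ∫⁻ x' : Fin d → ℝ, ENNReal.ofReal (M * tailBound γ c K x') ≠ ∞ := by
    have h1 : ∀ x' : Fin d → ℝ, ENNReal.ofReal (M * tailBound γ c K x') =
        ENNReal.ofReal M * ENNReal.ofReal (tailBound γ c K x') := fun x' =>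
      ENNReal.ofReal_mul (by linarith)
    simp_rw [h1]
    rw [lintegral_const_mul' _ _ ENNReal.ofReal_ne_top]
    exact ENNReal.mul_ne_top ENNReal.ofReal_ne_top (lintegral_tailBound_lt_top hγ hc).ne
  have hlim : Tendsto (fun i => ∫⁻ x' : Fin d → ℝ, ENNReal.ofReal
      (Real.exp (-excess γ (d * Real.log (r i)) (pos i (latticePoint (r i) x')))))
      l (𝓝 (limitRate d γ κ x h)) := by
    refine tendsto_lintegral_filter_of_dominated_convergence _
      (Eventually.of_forall fun i => ?_) ?_ hdom ?_
    · have : Measurable fun z' => ENNReal.ofReal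
          (Real.exp (-excess γ (d * Real.log (r i)) (pos i z'))) := measurable_of_countable _
      exact this.comp (measurable_latticePoint (r i))
    · filter_upwards [hbound] with i hi
      exact Eventually.of_forall fun x' => ENNReal.ofReal_le_ofReal (hi x')
    · exact Eventually.of_forall fun x' => ENNReal.tendsto_ofReal (hpoint x')
  refine ⟨?_, ?_, ?_⟩
  · refine hlim.congr fun i => ?_
    have hr : 0 < r i := one_pos.trans (H.one_lt_r i)
    rw [tsum_eq_lintegral_latticePoint hr, ← lintegral_const_mul' _ _ ENNReal.ofReal_ne_top]
    refine lintegral_congr fun x' => ?_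
    rw [htail, ← ENNReal.ofReal_mul (by positivity), mul_inv_cancel_left₀ (by positivity)]
  · refine ne_top_of_le_ne_top hdom (lintegral_mono fun x' => ENNReal.ofReal_le_ofReal ?_)
    exact le_of_tendsto (hpoint x') (hbound.mono fun i hi => hi x')
  · have hz : Tendsto (fun i => (r i ^ d)⁻¹ * M) l (𝓝 0) := by
      have := ((tendsto_pow_atTop hd.ne').comp H.tendsto_r).inv_tendsto_atTop.mul_const M
      simpa using this
    refine squeeze_zero' (Eventually.of_forall fun i => Real.iSup_nonneg fun _ => (tail_pos _ _).le)
      ?_ hz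
    filter_upwards [hev] with i ⟨hi1, hi2, hi3⟩
    have hr : 0 < r i := one_pos.trans (H.one_lt_r i)
    refine ciSup_le fun z' => ?_
    rw [htail]
    gcongr
    refine le_trans ?_ hi2
    have h4 := hi3 _ (div_nonneg (latticeNorm_nonneg z') hr.le)
    have h5 : 0 ≤ c * (latticeNorm z' / r i + d) := by
      have := latticeNorm_nonneg z'
      positivity
    have := excess_mono hγ (H.log_pos hd i) (show -K ≤ pos i z' by linarith)
    gcongr

end

section
variable {d : ℕ} {γ κ : ℝ} {ι : Type*} {l : Filter ι} {r g₀ g₁ : ι → ℝ}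

/-- This is the Poisson approximation: the sum of the tail probabilities converges while their
supremum `σ` vanishes, so both bounds of `tprod_one_sub_bounds` have the same limit. Leaving out the
site itself removes a single term, at most `σ`. -/
theorem Scaling.tendsto_winProb (H : Scaling d γ κ l r g₀ g₁) [l.IsCountablyGenerated] [l.NeBot]
    (hd : 0 < d) (hγ : 0 < γ) (hκ : 0 < κ) (x : Fin d → ℝ) (h : ℝ) :
    Tendsto (fun i => winProb γ (g₀ i) (g₁ i) (latticePoint (r i) x)
      (height γ (d * Real.log (r i)) h)) l
      (𝓝 (ENNReal.ofReal (Real.exp (-(limitRate d γ κ x h).toReal)))) := by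
  obtain ⟨hS, hN, hσ⟩ := H.tendsto_sum_tail hd hγ hκ x h
  let z : ι → Fin d → ℤ := fun i => latticePoint (r i) x
  let p : ι → (Fin d → ℤ) → ℝ := fun i z' =>
    tail γ (height γ (d * Real.log (r i)) h + gap (g₀ i) (g₁ i) (z i) z')
  let σ : ι → ℝ := fun i => ⨆ z', p i z'
  have hp0 : ∀ i z', 0 ≤ p i z' := fun i z' => (tail_pos _ _).le
  have hpσ : ∀ i z', p i z' ≤ σ i := fun i z' =>
    le_ciSup (f := p i) ⟨1, by rintro _ ⟨y, rfl⟩; exact tail_le_one _ _⟩ z'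
  have hNr := (ENNReal.tendsto_toReal hN).comp hS
  have hpz : Tendsto (fun i => p i (z i)) l (𝓝 0) :=
    squeeze_zero (fun i => hp0 i _) (fun i => hpσ i _) hσ
  have hfin : ∀ᶠ i in l, ∑' z', ENNReal.ofReal (p i z') < ∞ :=
    hS.eventually_lt_const (lt_top_iff_ne_top.2 hN)
  have hsummable : ∀ᶠ i in l, Summable (p i) := by
    filter_upwards [hfin] with i hi
    have := ENNReal.summable_toReal hi.ne
    refine this.congr fun z' => ENNReal.toReal_ofReal (hp0 i z')
  let S' : ι → ℝ := fun i => ∑' z' : {z' : Fin d → ℤ // z' ≠ z i}, p i z'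
  have hS' : Tendsto S' l (𝓝 (limitRate d γ κ x h).toReal) := by
    have := hNr.sub hpz
    rw [sub_zero] at this
    refine this.congr' ?_
    filter_upwards [hsummable] with i hi
    have h1 : (∑' z', ENNReal.ofReal (p i z')).toReal = ∑' z', p i z' := by
      rw [ENNReal.tsum_toReal_eq fun _ => ENNReal.ofReal_ne_top]
      exact tsum_congr fun z' => ENNReal.toReal_ofReal (hp0 i z')
    have h2 := hi.sum_add_tsum_subtype_compl {z i}
    rw [Finset.sum_singleton] at h2
    have h3 : ∑' z' : {z' // z' ∉ ({z i} : Finset (Fin d → ℤ))}, p i z' = S' i :=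
      (Equiv.subtypeEquivRight (by simp)).tsum_eq
        (fun z' : {z' : Fin d → ℤ // z' ≠ z i} => p i z')
    simp only [Function.comp]
    change (∑' z', ENNReal.ofReal (p i z')).toReal - p i (z i) = S' i
    rw [h1, ← h2, h3]
    ring
  have hlow : Tendsto (fun i => ENNReal.ofReal (Real.exp (-S' i / (1 - σ i)))) l
      (𝓝 (ENNReal.ofReal (Real.exp (-(limitRate d γ κ x h).toReal)))) := by
    refine ENNReal.tendsto_ofReal ((Real.continuous_exp.tendsto _).comp ?_)
    have h4 := hS'.neg.div (tendsto_const_nhds.sub hσ) (show (1 : ℝ) - 0 ≠ 0 by norm_num)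
    rw [sub_zero, div_one] at h4
    exact h4
  have hup : Tendsto (fun i => ENNReal.ofReal (Real.exp (-S' i))) l
      (𝓝 (ENNReal.ofReal (Real.exp (-(limitRate d γ κ x h).toReal)))) :=
    ENNReal.tendsto_ofReal ((Real.continuous_exp.tendsto _).comp hS'.neg)
  have hbounds : ∀ᶠ i in l, ENNReal.ofReal (Real.exp (-S' i / (1 - σ i))) ≤
      winProb γ (g₀ i) (g₁ i) (z i) (height γ (d * Real.log (r i)) h) ∧
      winProb γ (g₀ i) (g₁ i) (z i) (height γ (d * Real.log (r i)) h) ≤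
        ENNReal.ofReal (Real.exp (-S' i)) := by
    filter_upwards [hsummable, hσ.eventually_lt_const one_pos] with i hi1 hi2
    exact tprod_one_sub_bounds (p := fun z' : {z' : Fin d → ℤ // z' ≠ z i} => p i z') hi2
      (fun _ => hp0 i _) (fun _ => hpσ i _) (hi1.subtype _)
  exact tendsto_of_tendsto_of_tendsto_of_le_of_le' hlow hup (hbounds.mono fun _ => And.left)
    (hbounds.mono fun _ => And.right)

end

/-! ### The Weibull distribution -/

/-- The standard exponential distribution. -/
noncomputable def expLaw : Measure ℝ :=
  (volume.restrict (Set.Ioi 0)).withDensity fun v => ENNReal.ofReal (Real.exp (-v))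

theorem expLaw_eq_of_ae {s : Set ℝ} (hs : MeasurableSet s) {y : ℝ}
    (h : Set.Ioi 0 ∩ s ⊆ Set.Ici y) (h' : Set.Ioi y ⊆ Set.Ioi 0 ∩ s) :
    expLaw s = ENNReal.ofReal (Real.exp (-y)) := by
  have hae : (s ∩ Set.Ioi 0 : Set ℝ) =ᵐ[volume] Set.Ioi y := by
    rw [Set.inter_comm]
    exact (LE.le.eventuallyLE h).trans Ioi_ae_eq_Ici.symm.le |>.antisymm
      (LE.le.eventuallyLE h')
  rw [expLaw, withDensity_apply _ hs, Measure.restrict_restrict hs, setLIntegral_congr hae,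
    ← ofReal_integral_eq_lintegral_ofReal (integrableOn_exp_neg_Ioi y)
      (Eventually.of_forall fun v => (Real.exp_pos _).le), integral_exp_neg_Ioi]

variable {Ω : Type*} [MeasurableSpace Ω] {P : Measure Ω} [IsProbabilityMeasure P] {d : ℕ}
  {γ : ℝ} {ξ : (Fin d → ℤ) → Ω → ℝ}

theorem measure_Iio (hγ : 0 < γ) (hξ : IsIIDWeibull P γ ξ) (z : Fin d → ℤ) (x : ℝ) :
    P.map (ξ z) (Set.Iio x) = ENNReal.ofReal (1 - tail γ x) := by
  rw [Measure.map_apply (hξ.measurable z) measurableSet_Iio]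
  have key : ∀ x, 0 ≤ x → P (ξ z ⁻¹' Set.Iio x) = ENNReal.ofReal (1 - tail γ x) := fun x hx => by
    rw [tail, max_eq_left hx, ← hξ.law z x hx, ofReal_measureReal]
    rfl
  rcases le_total 0 x with hx | hx
  · exact key x hx
  · have h0 : tail γ x = 1 := by simp [tail, max_eq_right hx, hγ.ne']
    have h1 : tail γ 0 = 1 := by simp [tail, hγ.ne']
    have h2 := key 0 le_rfl
    rw [h1, sub_self, ENNReal.ofReal_zero] at h2
    rw [h0, sub_self, ENNReal.ofReal_zero]
    exact measure_mono_null (Set.preimage_mono (Set.Iio_subset_Iio hx)) h2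

/-- The variable `ξ^γ` is standard exponential. Comparing half-lines suffices, and the maximum with
zero handles levels below the support. -/
theorem map_eq_map_expLaw (hγ : 0 < γ) (hξ : IsIIDWeibull P γ ξ) (z : Fin d → ℤ) :
    P.map (ξ z) = expLaw.map fun v => v ^ (1 / γ) := by
  have hm : Measurable fun v : ℝ => v ^ (1 / γ) := by fun_prop
  have := Measure.isProbabilityMeasure_map (μ := P) (hξ.measurable z).aemeasurable
  refine Measure.ext_of_Ici _ _ fun x => ?_
  have h1 : P.map (ξ z) (Set.Ici x) = ENNReal.ofReal (tail γ x) := by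
    have := prob_compl_eq_one_sub (μ := P.map (ξ z)) (measurableSet_Iio (a := x))
    rw [Set.compl_Iio] at this
    rw [this, measure_Iio hγ hξ, ← ENNReal.ofReal_one,
      ← ENNReal.ofReal_sub _ (by linarith [tail_le_one γ x])]
    congr 1
    ring
  rw [h1, Measure.map_apply hm measurableSet_Ici]
  refine (expLaw_eq_of_ae (hm measurableSet_Ici) ?_ ?_).symm
  · rintro v ⟨hv : 0 < v, hvx : x ≤ v ^ (1 / γ)⟩
    have : max x 0 ≤ v ^ (1 / γ) := max_le hvx (by positivity)
    calc (max x 0) ^ γ ≤ (v ^ (1 / γ)) ^ γ := by gcongr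
      _ = v := by rw [← Real.rpow_mul hv.le, one_div_mul_cancel hγ.ne', Real.rpow_one]
  · intro v (hv : (max x 0) ^ γ < v)
    have hv0 : 0 < v := lt_of_le_of_lt (by positivity) hv
    refine ⟨hv0, ?_⟩
    calc x ≤ max x 0 := le_max_left _ _
      _ = ((max x 0) ^ γ) ^ (1 / γ) := by
        rw [← Real.rpow_mul (le_max_right _ _), mul_one_div_cancel hγ.ne', Real.rpow_one]
      _ ≤ v ^ (1 / γ) := by gcongr

theorem nullSingletonClass_map (hγ : 0 < γ) (hξ : IsIIDWeibull P γ ξ) (z : Fin d → ℤ) :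
    NullSingletonClass (P.map (ξ z)) := by
  refine ⟨fun x => ?_⟩
  have hlim : Tendsto (fun n : ℕ => ENNReal.ofReal (tail γ x - tail γ (x + 1 / ((n : ℝ) + 1)))) atTop
      (𝓝 0) := by
    have h1 : Tendsto (fun n : ℕ => x + 1 / ((n : ℝ) + 1)) atTop (𝓝 (x + 0)) :=
      tendsto_const_nhds.add tendsto_one_div_add_atTop_nhds_zero_nat
    have h2 := ((continuous_tail hγ).tendsto _).comp h1
    have h3 := ENNReal.tendsto_ofReal ((tendsto_const_nhds (x := tail γ x)).sub h2)
    simpa using h3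
  refine le_antisymm (ge_of_tendsto' hlim fun n => ?_) zero_le
  have hpos : (0 : ℝ) < 1 / ((n : ℝ) + 1) := by positivity
  have h4 : ({x} : Set ℝ) ⊆ Set.Iio (x + 1 / ((n : ℝ) + 1)) \ Set.Iio x := by
    rintro _ rfl
    simp only [Set.mem_sdiff, Set.mem_Iio, lt_irrefl, not_false_iff, and_true]
    linarith
  have := Measure.isProbabilityMeasure_map (μ := P) (hξ.measurable z).aemeasurable
  refine (measure_mono h4).trans ?_
  rw [measure_sdiff (Set.Iio_subset_Iio (by linarith)) measurableSet_Iio.nullMeasurableSet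
    (measure_ne_top _ _), measure_Iio hγ hξ, measure_Iio hγ hξ,
    ← ENNReal.ofReal_sub _ (by linarith [tail_le_one γ x])]
  exact ENNReal.ofReal_le_ofReal (by linarith)

/-! ### The probability of staying as an integral over position and height -/

section
variable {Ω : Type*} [MeasurableSpace Ω] {P : Measure Ω} [IsProbabilityMeasure P] {d : ℕ}
  {γ : ℝ} {ξ : (Fin d → ℤ) → Ω → ℝ}

/-- The event that `z` beats all other points for both slopes `g₀`, `g₁`. -/
def wins (ξ : (Fin d → ℤ) → Ω → ℝ) (g₀ g₁ : ℝ) (z : Fin d → ℤ) : Set Ω :=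
  {ω | ∀ z', z' ≠ z → ξ z' ω < ξ z ω + gap g₀ g₁ z z'}

/-- The event that one and the same point beats all other points for both slopes `g₀`, `g₁`. -/
def stays (ξ : (Fin d → ℤ) → Ω → ℝ) (g₀ g₁ : ℝ) : Set Ω := ⋃ z, wins ξ g₀ g₁ z

theorem measurableSet_wins (hξ : ∀ z, Measurable (ξ z)) (g₀ g₁ : ℝ) (z : Fin d → ℤ) :
    MeasurableSet (wins ξ g₀ g₁ z) := by
  simp only [wins, Set.ofPred_forall]
  exact MeasurableSet.iInter fun z' => MeasurableSet.iInter fun _ =>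
    measurableSet_lt (hξ z') ((hξ z).add_const _)

theorem measurableSet_stays (hξ : ∀ z, Measurable (ξ z)) (g₀ g₁ : ℝ) :
    MeasurableSet (stays ξ g₀ g₁) :=
  MeasurableSet.iUnion fun z => measurableSet_wins hξ g₀ g₁ z

/-- Already for the slope `g₀` two sites cannot strictly beat each other. -/
theorem pairwise_disjoint_wins {Ω' : Type*} (ξ : (Fin d → ℤ) → Ω' → ℝ) (g₀ g₁ : ℝ) :
    Pairwise (Function.onFun Disjoint (wins ξ g₀ g₁)) := by
  intro z₁ z₂ hne
  refine Set.disjoint_left.2 fun ω h₁ h₂ => ?_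
  have a := h₁ z₂ hne.symm
  have b := h₂ z₁ hne
  have c : gap g₀ g₁ z₁ z₂ ≤ g₀ * (latticeNorm z₂ - latticeNorm z₁) := min_le_left _ _
  have e : gap g₀ g₁ z₂ z₁ ≤ g₀ * (latticeNorm z₁ - latticeNorm z₂) := min_le_left _ _
  linarith

theorem measurable_winProb (hγ : 0 < γ) (g₀ g₁ : ℝ) (z : Fin d → ℤ) :
    Measurable (winProb γ g₀ g₁ z) := by
  have h : winProb γ g₀ g₁ z = fun u => ⨅ F : Finset {z' : Fin d → ℤ // z' ≠ z},
      ∏ z' ∈ F, ENNReal.ofReal (1 - tail γ (u + gap g₀ g₁ z z')) := by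
    funext u
    refine ENNReal.tprod_eq_iInf_prod fun z' => ?_
    rw [ENNReal.ofReal_le_one]
    linarith [tail_pos γ (u + gap g₀ g₁ z z')]
  rw [h]
  have := continuous_tail hγ
  exact Measurable.iInf fun F => Finset.measurable_prod _ fun z' _ => by fun_prop

theorem indepFun_others (hξ : IsIIDWeibull P γ ξ) (z : Fin d → ℤ) :
    IndepFun (ξ z) (fun ω (z' : {z' : Fin d → ℤ // z' ≠ z}) => ξ z' ω) P := by
  classical
  refine IndepFun.indepFun_process (hξ.measurable z) (fun z' => hξ.measurable z') fun I => ?_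
  have hdisj : Disjoint ({z} : Finset (Fin d → ℤ)) (I.map (Function.Embedding.subtype _)) := by
    rw [Finset.disjoint_singleton_left]
    simp
  have h := hξ.indep.indepFun_finset _ _ hdisj hξ.measurable
  have hφ : Measurable fun (f : ({z} : Finset (Fin d → ℤ)) → ℝ) => f ⟨z, Finset.mem_singleton_self z⟩ := by
    fun_prop
  have hψ : Measurable fun (f : (I.map (Function.Embedding.subtype _) : Finset (Fin d → ℤ)) → ℝ)
      (i : I) => f ⟨i.1.1, Finset.mem_map_of_mem _ i.2⟩ := by
    fun_prop
  exact h.comp hφ hψ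

theorem map_others_apply (hγ : 0 < γ) (hξ : IsIIDWeibull P γ ξ) (z : Fin d → ℤ) (g₀ g₁ u : ℝ) :
    P.map (fun ω (z' : {z' : Fin d → ℤ // z' ≠ z}) => ξ z' ω)
      (Set.univ.pi fun z' => Set.Iio (u + gap g₀ g₁ z z')) = winProb γ g₀ g₁ z u := by
  have hi : iIndepFun (fun z' : {z' : Fin d → ℤ // z' ≠ z} => ξ z') P :=
    hξ.indep.precomp Subtype.val_injective
  rw [iIndepFun.map_fun_eq_infinitePi_map (X := fun z' : {z' : Fin d → ℤ // z' ≠ z} => ξ z')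
    (fun z' => hξ.measurable z') hi]
  have (z' : {z' : Fin d → ℤ // z' ≠ z}) : IsProbabilityMeasure (P.map (ξ z')) :=
    Measure.isProbabilityMeasure_map (hξ.measurable z').aemeasurable
  rw [Measure.infinitePi_pi_univ _ fun _ => measurableSet_Iio]
  exact tprod_congr fun z' => measure_Iio hγ hξ _ _

/-- Conditioning on `ξ z`: by independence the law of the whole field factorises, and for fixed
height the other sites contribute an infinite product. -/
theorem measure_wins (hγ : 0 < γ) (hξ : IsIIDWeibull P γ ξ) (g₀ g₁ : ℝ) (z : Fin d → ℤ) :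
    P (wins ξ g₀ g₁ z) =
      ∫⁻ v in Set.Ioi 0, ENNReal.ofReal (Real.exp (-v)) * winProb γ g₀ g₁ z (v ^ (1 / γ)) := by
  let Y : Ω → {z' : Fin d → ℤ // z' ≠ z} → ℝ := fun ω z' => ξ z' ω
  have hY : Measurable Y := measurable_pi_lambda _ fun z' => hξ.measurable z'
  let B : Set (ℝ × ({z' : Fin d → ℤ // z' ≠ z} → ℝ)) :=
    {q | ∀ z', q.2 z' < q.1 + gap g₀ g₁ z z'}
  have hB : MeasurableSet B := by
    simp only [B, Set.ofPred_forall]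
    exact MeasurableSet.iInter fun z' => measurableSet_lt (by fun_prop) (by fun_prop)
  have h1 : wins ξ g₀ g₁ z = (fun ω => (ξ z ω, Y ω)) ⁻¹' B := by
    ext ω
    simp [wins, B, Y]
  have hind := (indepFun_iff_map_prod_eq_prod_map_map (hξ.measurable z).aemeasurable
    hY.aemeasurable).1 (indepFun_others hξ z)
  have hPY := Measure.isProbabilityMeasure_map (μ := P) hY.aemeasurable
  rw [h1, ← Measure.map_apply ((hξ.measurable z).prodMk hY) hB, hind, Measure.prod_apply hB]
  have h2 : ∀ u : ℝ, P.map Y (Prod.mk u ⁻¹' B) = winProb γ g₀ g₁ z u := fun u => by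
    rw [← map_others_apply hγ hξ z g₀ g₁ u]
    congr 1
    ext f
    simp [B]
  simp_rw [h2]
  have hw := measurable_winProb (d := d) hγ g₀ g₁ z
  rw [map_eq_map_expLaw hγ hξ z, lintegral_map hw (by fun_prop), expLaw,
    lintegral_withDensity_eq_lintegral_mul _ (by fun_prop)
      (g := fun v => winProb γ g₀ g₁ z (v ^ (1 / γ))) (hw.comp (by fun_prop))]
  rfl

/-- In the exponential variable `v = ξ^γ` heights are the affine function `A + γ h`. The formula
needs this to be positive, hence the cut-off in `winDensity`. -/
theorem height_eq {A h : ℝ} (hA : 0 < A) (hh : 0 < A + γ * h) :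
    height γ A h = (A + γ * h) ^ (1 / γ) := by
  have h1 : 0 < 1 + γ * h / A := by
    have : 1 + γ * h / A = (A + γ * h) / A := by field_simp
    rw [this]
    positivity
  have h2 : A + γ * h = A * (1 + γ * h / A) := by field_simp
  rw [height, level_eq hA, excess, max_eq_left h1.le, mul_div_cancel_left₀ _ hA.ne', h2,
    Real.mul_rpow hA.le h1.le]
  ring

theorem lintegral_exp_change (hγ : 0 < γ) (A : ℝ) {G : ℝ → ℝ≥0∞} (hG : Measurable G) :
    ∫⁻ v in Set.Ioi 0, ENNReal.ofReal (Real.exp (-v)) * G v =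
      ENNReal.ofReal (Real.exp (-A)) * ∫⁻ h : ℝ, if 0 < A + γ * h then
        ENNReal.ofReal (γ * Real.exp (-γ * h)) * G (A + γ * h) else 0 := by
  let f : ℝ → ℝ≥0∞ := fun v => if 0 < v then ENNReal.ofReal (Real.exp (-v)) * G v else 0
  have hf : Measurable f := Measurable.ite measurableSet_Ioi (by fun_prop) measurable_const
  have h1 : ∫⁻ v in Set.Ioi 0, ENNReal.ofReal (Real.exp (-v)) * G v = ∫⁻ v, f v := by
    rw [← lintegral_indicator measurableSet_Ioi]
    rfl
  have h2 : ∫⁻ v, f v = ∫⁻ v, f (A + v) := (lintegral_add_left_eq_self f A).symm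
  have h3 : ∫⁻ v, f (A + v) = ENNReal.ofReal γ * ∫⁻ h, f (A + γ * h) := by
    have := Real.smul_map_volume_mul_left hγ.ne'
    conv_lhs => rw [← this]
    rw [lintegral_smul_measure, abs_of_pos hγ,
      lintegral_map (f := fun v => f (A + v)) (hf.comp (by fun_prop)) (by fun_prop), smul_eq_mul]
  rw [h1, h2, h3, ← lintegral_const_mul' _ _ ENNReal.ofReal_ne_top,
    ← lintegral_const_mul' _ _ ENNReal.ofReal_ne_top]
  refine lintegral_congr fun h => ?_
  simp only [f]
  split_ifs with hpos
  · rw [← mul_assoc, ← mul_assoc, ← ENNReal.ofReal_mul hγ.le,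
      ← ENNReal.ofReal_mul (Real.exp_pos _).le, neg_add, Real.exp_add]
    congr 2
    ring_nf
  · simp

/-- The density of the rescaled position and height of a point that beats all others for both
slopes. -/
noncomputable def winDensity (d : ℕ) (γ r g₀ g₁ : ℝ) (q : (Fin d → ℝ) × ℝ) : ℝ≥0∞ :=
  if 0 < d * Real.log r + γ * q.2 then ENNReal.ofReal (γ * Real.exp (-γ * q.2)) *
    winProb γ g₀ g₁ (latticePoint r q.1) (height γ (d * Real.log r) q.2) else 0

theorem measurable_height (hγ : 0 < γ) (A : ℝ) : Measurable (height γ A) := by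
  unfold height level excess
  have : (0 : ℝ) ≤ 1 / γ := by positivity
  fun_prop (disch := assumption)

theorem measurable_winDensity (hγ : 0 < γ) (r g₀ g₁ : ℝ) :
    Measurable (winDensity d γ r g₀ g₁) := by
  have hw : Measurable fun q : (Fin d → ℤ) × ℝ => winProb γ g₀ g₁ q.1 q.2 :=
    measurable_from_prod_countable_right fun z => measurable_winProb hγ g₀ g₁ z
  have hpair : Measurable fun q : (Fin d → ℝ) × ℝ =>
      (latticePoint r q.1, height γ (d * Real.log r) q.2) :=
    ((measurable_latticePoint r).comp measurable_fst).prodMk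
      ((measurable_height hγ _).comp measurable_snd)
  have hcomp := hw.comp hpair
  refine Measurable.ite (measurableSet_lt measurable_const (by fun_prop)) ?_ measurable_const
  exact Measurable.mul (by fun_prop) hcomp

/-- An exact identity for every scale `r > 1`: the factor `r^d` of the lattice sum cancels the
factor `e^{-d log r}` of the exponential density. -/
theorem measure_stays (hd : 0 < d) (hγ : 0 < γ) (hξ : IsIIDWeibull P γ ξ) {r : ℝ} (hr : 1 < r)
    (g₀ g₁ : ℝ) : P (stays ξ g₀ g₁) = ∫⁻ q, winDensity d γ r g₀ g₁ q := by
  have hr0 : 0 < r := one_pos.trans hr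
  have hA : 0 < d * Real.log r := by
    have := Real.log_pos hr
    positivity
  have hexp : r ^ d * Real.exp (-(d * Real.log r)) = 1 := by
    rw [← neg_mul, mul_comm (-(d : ℝ)), Real.exp_mul, Real.exp_log hr0, Real.rpow_neg hr0.le,
      Real.rpow_natCast]
    exact mul_inv_cancel₀ (by positivity)
  rw [stays, measure_iUnion (pairwise_disjoint_wins ξ g₀ g₁)
    (measurableSet_wins hξ.measurable g₀ g₁), tsum_eq_lintegral_latticePoint hr0,
    Measure.volume_eq_prod, lintegral_prod _ (measurable_winDensity hγ r g₀ g₁).aemeasurable,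
    ← lintegral_const_mul' _ _ ENNReal.ofReal_ne_top]
  refine lintegral_congr fun x => ?_
  have hw := measurable_winProb hγ g₀ g₁ (latticePoint r x)
  rw [measure_wins hγ hξ, lintegral_exp_change hγ (d * Real.log r)
    (G := fun v => winProb γ g₀ g₁ (latticePoint r x) (v ^ (1 / γ))) (hw.comp (by fun_prop)),
    ← mul_assoc, ← ENNReal.ofReal_mul (by positivity), hexp, ENNReal.ofReal_one, one_mul]
  refine lintegral_congr fun h => ?_
  simp only [winDensity]
  split_ifs with hpos
  · rw [height_eq hA hpos]
  · rfl

end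

/-! ### The limiting probability of staying and convergence to it -/

/-- `exp (-a)` for `a ∈ [0, ∞]`. -/
noncomputable def expNeg (a : ℝ≥0∞) : ℝ≥0∞ := EReal.exp (-(a : EReal))

theorem continuous_expNeg : Continuous expNeg :=
  ENNReal.continuous_exp.comp (continuous_neg.comp continuous_coe_ennreal_ereal)

theorem expNeg_antitone : Antitone expNeg := fun a b h => by
  unfold expNeg
  rw [EReal.exp_le_exp_iff, EReal.neg_le_neg_iff]
  exact_mod_cast h

theorem expNeg_of_ne_top {a : ℝ≥0∞} (ha : a ≠ ∞) :
    expNeg a = ENNReal.ofReal (Real.exp (-a.toReal)) := by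
  rw [expNeg, ← EReal.exp_coe, EReal.coe_neg, EReal.coe_ennreal_toReal ha]

theorem expNeg_top : expNeg ∞ = 0 := by simp [expNeg]

/-- Having to win for a second slope can only hurt. The equal-slope density thus dominates, and its
integral is known to be one. -/
theorem winProb_mono {d : ℕ} {γ : ℝ} (hγ : 0 < γ) (g₀ g₁ : ℝ) (z : Fin d → ℤ) (u : ℝ) :
    winProb γ g₀ g₁ z u ≤ winProb γ g₀ g₀ z u := by
  have h1 : ∀ a : ℝ, ENNReal.ofReal (1 - tail γ a) ≤ 1 := fun a => by
    rw [ENNReal.ofReal_le_one]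
    linarith [tail_pos γ a]
  rw [winProb, winProb, ENNReal.tprod_eq_iInf_prod fun _ => h1 _,
    ENNReal.tprod_eq_iInf_prod fun _ => h1 _]
  refine iInf_mono fun F => Finset.prod_le_prod' fun z' _ => ENNReal.ofReal_le_ofReal ?_
  have hgap : gap g₀ g₁ z z' ≤ gap g₀ g₀ z z' := by
    unfold gap
    rw [min_self]
    exact min_le_left _ _
  linarith [tail_antitone hγ (add_le_add_right hgap u)]

/-- The limit of `winDensity`. -/
noncomputable def limitDensity (d : ℕ) (γ κ : ℝ) (q : (Fin d → ℝ) × ℝ) : ℝ≥0∞ :=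
  ENNReal.ofReal (γ * Real.exp (-γ * q.2)) * expNeg (limitRate d γ κ q.1 q.2)

/-- The limiting probability that one point beats all others for two slopes of ratio `κ`. -/
noncomputable def stayProb (d : ℕ) (γ κ : ℝ) : ℝ≥0∞ := ∫⁻ q, limitDensity d γ κ q

section
variable {d : ℕ} {γ κ : ℝ}

theorem measurable_limitRate : Measurable fun q : (Fin d → ℝ) × ℝ => limitRate d γ κ q.1 q.2 := by
  have hc := continuous_l1Norm (d := d)
  refine Measurable.lintegral_prod_right' (f := fun p : ((Fin d → ℝ) × ℝ) × (Fin d → ℝ) =>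
    ENNReal.ofReal (Real.exp (-(γ * (p.1.2 + min (theta d γ * (l1Norm p.2 - l1Norm p.1.1))
      (κ * theta d γ * (l1Norm p.2 - l1Norm p.1.1))))))) ?_
  refine ENNReal.measurable_ofReal.comp (Continuous.measurable ?_)
  fun_prop

theorem measurable_limitDensity : Measurable (limitDensity d γ κ) := by
  have := (continuous_expNeg.measurable).comp (measurable_limitRate (d := d) (γ := γ) (κ := κ))
  exact Measurable.mul (by fun_prop) this

theorem limitRate_anti (hd : 0 < d) (hγ : 0 < γ) {κ' : ℝ} (h : κ ≤ κ') (hκ' : κ' ≤ 1)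
    (x : Fin d → ℝ) (y : ℝ) : limitRate d γ κ' x y ≤ limitRate d γ κ x y := by
  have hθ := theta_pos hd hγ
  refine lintegral_mono fun x' => ENNReal.ofReal_le_ofReal ?_
  have : min (theta d γ * (l1Norm x' - l1Norm x)) (κ * theta d γ * (l1Norm x' - l1Norm x)) ≤
      min (theta d γ * (l1Norm x' - l1Norm x)) (κ' * theta d γ * (l1Norm x' - l1Norm x)) := by
    set q := theta d γ * (l1Norm x' - l1Norm x) with hq
    rw [mul_assoc, mul_assoc, ← hq]
    -- For sites nearer to the origin than `x` the larger slope decides, so the minimum is `q`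
    -- whatever the ratio in use.
    rcases le_total 0 q with h0 | h0
    · exact min_le_min_left _ (by gcongr)
    · rw [min_eq_left (show q ≤ κ * q by nlinarith), min_eq_left (show q ≤ κ' * q by nlinarith)]
  gcongr

theorem limitDensity_mono (hd : 0 < d) (hγ : 0 < γ) {κ' : ℝ} (h : κ ≤ κ') (hκ' : κ' ≤ 1)
    (q : (Fin d → ℝ) × ℝ) : limitDensity d γ κ q ≤ limitDensity d γ κ' q := by
  unfold limitDensity
  gcongr
  exact expNeg_antitone (limitRate_anti hd hγ h hκ' _ _)

theorem lintegral_exp_neg_l1Norm_lt_top {c : ℝ} (hc : 0 < c) :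
    ∫⁻ x : Fin d → ℝ, ENNReal.ofReal (Real.exp (-(c * l1Norm x))) < ∞ := by
  have h := lintegral_tailBound_lt_top (d := d) (γ := 1) (c := c) (K := 0) one_pos hc
  have h1 : ∀ x : Fin d → ℝ, tailBound 1 c 0 x = Real.exp (-(c * l1Norm x)) := fun x => by
    have := mul_nonneg hc.le (l1Norm_nonneg x)
    simp [tailBound, this]
  simpa only [h1] using h

/-- An integrable bound for the integrand of `limitRate`. -/
theorem limitRate_integrand_le (hd : 0 < d) (hγ : 0 < γ) {c : ℝ} (hcκ : c ≤ κ) (hκ1 : κ ≤ 1)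
    (x x' : Fin d → ℝ) (h : ℝ) :
    ENNReal.ofReal (Real.exp (-(γ * (h + min (theta d γ * (l1Norm x' - l1Norm x))
      (κ * theta d γ * (l1Norm x' - l1Norm x)))))) ≤
    ENNReal.ofReal (Real.exp (-(γ * (h - theta d γ * l1Norm x)))) *
      ENNReal.ofReal (Real.exp (-(γ * c * theta d γ * l1Norm x'))) := by
  have hθ := theta_pos hd hγ
  rw [← ENNReal.ofReal_mul (Real.exp_pos _).le, ← Real.exp_add]
  refine ENNReal.ofReal_le_ofReal (Real.exp_le_exp.2 ?_)
  have hmin := min_mul_ge (a := theta d γ) (b := κ * theta d γ) (by nlinarith) (l1Norm_nonneg x)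
    (l1Norm_nonneg x')
  have h2 : c * (theta d γ * l1Norm x') ≤ κ * (theta d γ * l1Norm x') :=
    mul_le_mul_of_nonneg_right hcκ (mul_nonneg hθ.le (l1Norm_nonneg x'))
  nlinarith

theorem lintegral_bound_ne_top (hd : 0 < d) (hγ : 0 < γ) {c : ℝ} (hc : 0 < c) (b : ℝ) :
    ∫⁻ x' : Fin d → ℝ, ENNReal.ofReal b *
      ENNReal.ofReal (Real.exp (-(γ * c * theta d γ * l1Norm x'))) ≠ ∞ := by
  have hθ := theta_pos hd hγ
  rw [lintegral_const_mul' _ _ ENNReal.ofReal_ne_top]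
  exact ENNReal.mul_ne_top ENNReal.ofReal_ne_top
    (lintegral_exp_neg_l1Norm_lt_top (by positivity)).ne

theorem limitRate_ne_top (hd : 0 < d) (hγ : 0 < γ) (hκ : 0 < κ) (hκ1 : κ ≤ 1)
    (x : Fin d → ℝ) (h : ℝ) : limitRate d γ κ x h ≠ ∞ :=
  ne_top_of_le_ne_top (lintegral_bound_ne_top hd hγ hκ _)
    (lintegral_mono fun x' => limitRate_integrand_le hd hγ le_rfl hκ1 x x' h)

theorem tendsto_limitRate (hd : 0 < d) (hγ : 0 < γ) (hκ : 0 < κ) {ι : Type*} {l : Filter ι}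
    [l.IsCountablyGenerated] {k : ι → ℝ} (hk1 : ∀ i, k i ≤ 1) (hk : Tendsto k l (𝓝 κ))
    (x : Fin d → ℝ) (h : ℝ) :
    Tendsto (fun i => limitRate d γ (k i) x h) l (𝓝 (limitRate d γ κ x h)) := by
  have hc := (continuous_l1Norm (d := d)).measurable
  refine tendsto_lintegral_filter_of_dominated_convergence _
    (Eventually.of_forall fun i => by fun_prop) ?_
    (lintegral_bound_ne_top hd hγ (half_pos hκ)
      (Real.exp (-(γ * (h - theta d γ * l1Norm x))))) (Eventually.of_forall fun x' => ?_)
  · filter_upwards [hk.eventually_const_lt (half_lt_self hκ)] with i hi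
    exact Eventually.of_forall fun x' => limitRate_integrand_le hd hγ hi.le (hk1 i) x x' h
  · refine ENNReal.tendsto_ofReal ((Real.continuous_exp.tendsto _).comp ?_)
    exact ((tendsto_const_nhds.add (tendsto_const_nhds.min
      ((hk.mul_const _).mul_const _))).const_mul γ).neg

/-- At `κ = 0` the integrand is at least the constant `e^{-γ h}` on a space of infinite volume;
Fatou's lemma transfers the divergence to small `κ`. -/
theorem tendsto_limitRate_zero (hd : 0 < d) (hγ : 0 < γ) {ι : Type*} {l : Filter ι}
    [l.IsCountablyGenerated] {k : ι → ℝ} (hk : Tendsto k l (𝓝 0)) (x : Fin d → ℝ) (h : ℝ) :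
    Tendsto (fun i => limitRate d γ (k i) x h) l (𝓝 ∞) := by
  have hc := (continuous_l1Norm (d := d)).measurable
  have : Nonempty (Fin d) := ⟨⟨0, hd⟩⟩
  refine tendsto_of_le_liminf_of_limsup_le (le_trans ?_ (lintegral_liminf_le fun i => by fun_prop))
    le_top
  have hlow : ∫⁻ _ : Fin d → ℝ, ENNReal.ofReal (Real.exp (-(γ * h))) = ∞ := by
    rw [lintegral_const, volume_pi, Measure.pi_univ]
    simp only [Real.volume_univ, Finset.prod_const, Finset.card_univ, Fintype.card_fin]
    rw [ENNReal.top_pow hd.ne', ENNReal.mul_top]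
    simp [Real.exp_pos]
  rw [← hlow]
  rcases l.eq_or_neBot with rfl | hl
  · simp
  refine lintegral_mono fun x' => ?_
  have hlim : Tendsto (fun i => ENNReal.ofReal (Real.exp (-(γ * (h +
      min (theta d γ * (l1Norm x' - l1Norm x)) (k i * theta d γ * (l1Norm x' - l1Norm x))))))) l
      (𝓝 (ENNReal.ofReal (Real.exp (-(γ * (h +
      min (theta d γ * (l1Norm x' - l1Norm x)) (0 * theta d γ * (l1Norm x' - l1Norm x)))))))) := by
    refine ENNReal.tendsto_ofReal ((Real.continuous_exp.tendsto _).comp ?_)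
    exact ((tendsto_const_nhds.add (tendsto_const_nhds.min
      ((hk.mul_const _).mul_const _))).const_mul γ).neg
  rw [hlim.liminf_eq]
  refine ENNReal.ofReal_le_ofReal (Real.exp_le_exp.2 ?_)
  have : min (theta d γ * (l1Norm x' - l1Norm x)) (0 * theta d γ * (l1Norm x' - l1Norm x)) ≤ 0 :=
    (min_le_right _ _).trans (by simp)
  nlinarith

/-- The function `exp (-C e^{-γ y}) / C` is an antiderivative, rising from `0` to `1 / C`. -/
theorem lintegral_gumbel (hγ : 0 < γ) {C : ℝ} (hC : 0 < C) :
    ∫⁻ y : ℝ, ENNReal.ofReal (γ * Real.exp (-γ * y) * Real.exp (-(C * Real.exp (-γ * y)))) =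
      ENNReal.ofReal C⁻¹ := by
  let F : ℝ → ℝ := fun y => Real.exp (-(C * Real.exp (-γ * y))) / C
  have hF : ∀ y, HasDerivAt F (γ * Real.exp (-γ * y) * Real.exp (-(C * Real.exp (-γ * y)))) y := by
    intro y
    have h1 : HasDerivAt (fun y : ℝ => -γ * y) (-γ) y := by
      simpa using (hasDerivAt_id y).const_mul (-γ)
    have h2 := (((h1.exp.const_mul C).neg).exp).div_const C
    refine h2.congr_deriv ?_
    simp only [Pi.neg_apply]
    field_simp
  have hbot : Tendsto (fun n : ℕ => F (-n)) atTop (𝓝 0) := by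
    have h1 : Tendsto (fun n : ℕ => C * Real.exp (-γ * -(n : ℝ))) atTop atTop := by
      refine Tendsto.const_mul_atTop hC (Real.tendsto_exp_atTop.comp ?_)
      simpa using tendsto_natCast_atTop_atTop.const_mul_atTop hγ
    have h2 := (Real.tendsto_exp_neg_atTop_nhds_zero.comp h1).div_const C
    simpa [F, Function.comp_def] using h2
  have htop : Tendsto (fun n : ℕ => F n) atTop (𝓝 C⁻¹) := by
    have h1 : Tendsto (fun n : ℕ => Real.exp (-γ * (n : ℝ))) atTop (𝓝 0) := by
      have := Real.tendsto_exp_neg_atTop_nhds_zero.comp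
        ((tendsto_natCast_atTop_atTop (R := ℝ)).const_mul_atTop hγ)
      simpa [Function.comp_def] using this
    have h2 := ((Real.continuous_exp.tendsto _).comp (h1.const_mul C).neg).div_const C
    simpa [F, Function.comp_def] using h2
  have hcover : AECover volume atTop fun n : ℕ => Set.Ioc (-(n : ℝ)) n :=
    aecover_Ioc (tendsto_neg_atTop_atBot.comp tendsto_natCast_atTop_atTop)
      tendsto_natCast_atTop_atTop
  refine hcover.lintegral_eq_of_tendsto _ (by fun_prop) ?_
  have := ENNReal.tendsto_ofReal (htop.sub hbot)
  rw [sub_zero] at this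
  refine this.congr fun n => ?_
  have hcont : Continuous fun y : ℝ =>
      γ * Real.exp (-γ * y) * Real.exp (-(C * Real.exp (-γ * y))) := by fun_prop
  have hn : -(n : ℝ) ≤ n := by linarith [(Nat.cast_nonneg n : (0 : ℝ) ≤ n)]
  rw [← intervalIntegral.integral_eq_sub_of_hasDerivAt (fun y _ => hF y)
    (hcont.intervalIntegrable _ _), intervalIntegral.integral_of_le hn,
    ofReal_integral_eq_lintegral_ofReal (hcont.integrableOn_Ioc)
      (Eventually.of_forall fun y => by positivity)]

/-- Change of variables from the height to the value of the rescaled functional. -/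
theorem lintegral_shear {G : (Fin d → ℝ) × ℝ → ℝ≥0∞} (hG : Measurable G) (c : ℝ) :
    ∫⁻ q, G q = ∫⁻ q : (Fin d → ℝ) × ℝ, G (q.1, q.2 + c * l1Norm q.1) := by
  have hc := (continuous_l1Norm (d := d)).measurable
  rw [Measure.volume_eq_prod, lintegral_prod _ hG.aemeasurable,
    lintegral_prod _ (Measurable.aemeasurable (by fun_prop))]
  exact lintegral_congr fun x =>
    (lintegral_add_right_eq_self (fun h => G (x, h)) (c * l1Norm x)).symm

/-- After the shear `h = y + θ|x|` the rate for `κ = 1` is `C e^{-γ y}`, independent of `x`, with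
`C` the integral of `e^{-γθ|x|}`. Position and value then separate, with masses `C` and `1 / C`. -/
theorem stayProb_one (hd : 0 < d) (hγ : 0 < γ) : stayProb d γ 1 = 1 := by
  have hθ := theta_pos hd hγ
  have hmeas := (continuous_l1Norm (d := d)).measurable
  set c := γ * theta d γ with hc
  have hc0 : 0 < c := by positivity
  set C := ∫⁻ x : Fin d → ℝ, ENNReal.ofReal (Real.exp (-(c * l1Norm x))) with hC
  have hCtop : C ≠ ∞ := (lintegral_exp_neg_l1Norm_lt_top hc0).ne
  have hC0 : C ≠ 0 := by
    rw [hC, Ne, lintegral_eq_zero_iff (by fun_prop)]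
    intro h
    have h1 : (volume : Measure (Fin d → ℝ)) = 0 := by
      rw [← ae_eq_bot, ← Filter.eventually_false_iff_eq_bot]
      filter_upwards [h] with x hx
      simp only [Pi.zero_apply, ENNReal.ofReal_eq_zero] at hx
      exact absurd hx (not_le.2 (Real.exp_pos _))
    exact NeZero.ne _ h1
  have hCr : 0 < C.toReal := ENNReal.toReal_pos hC0 hCtop
  have hrate : ∀ (x : Fin d → ℝ) (y : ℝ), limitRate d γ 1 x (y + theta d γ * l1Norm x) =
      ENNReal.ofReal (C.toReal * Real.exp (-γ * y)) := fun x y => by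
    rw [ENNReal.ofReal_mul hCr.le, ENNReal.ofReal_toReal hCtop, mul_comm C, limitRate, hC,
      ← lintegral_const_mul' _ _ ENNReal.ofReal_ne_top]
    refine lintegral_congr fun x' => ?_
    rw [← ENNReal.ofReal_mul (Real.exp_pos _).le, ← Real.exp_add, one_mul, min_self]
    congr 2
    rw [hc]
    ring
  rw [stayProb, lintegral_shear measurable_limitDensity (theta d γ)]
  have hdens : ∀ q : (Fin d → ℝ) × ℝ, limitDensity d γ 1 (q.1, q.2 + theta d γ * l1Norm q.1) =
      ENNReal.ofReal (Real.exp (-(c * l1Norm q.1))) * ENNReal.ofReal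
        (γ * Real.exp (-γ * q.2) * Real.exp (-(C.toReal * Real.exp (-γ * q.2)))) := fun q => by
    rw [limitDensity]
    simp only
    rw [hrate, expNeg_of_ne_top ENNReal.ofReal_ne_top, ENNReal.toReal_ofReal (by positivity),
      ← ENNReal.ofReal_mul (by positivity), ← ENNReal.ofReal_mul (by positivity), mul_add,
      Real.exp_add]
    congr 1
    rw [hc]
    ring_nf
  simp_rw [hdens]
  rw [Measure.volume_eq_prod, lintegral_prod_mul
    (f := fun x : Fin d → ℝ => ENNReal.ofReal (Real.exp (-(c * l1Norm x))))
    (g := fun y : ℝ => ENNReal.ofReal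
      (γ * Real.exp (-γ * y) * Real.exp (-(C.toReal * Real.exp (-γ * y)))))
    (Measurable.aemeasurable (by fun_prop)) (Measurable.aemeasurable (by fun_prop)),
    lintegral_gumbel hγ hCr, ← hC,
    ENNReal.ofReal_inv_of_pos hCr, ENNReal.ofReal_toReal hCtop, ENNReal.mul_inv_cancel hC0 hCtop]

theorem stayProb_le_one (hd : 0 < d) (hγ : 0 < γ) (hκ1 : κ ≤ 1) : stayProb d γ κ ≤ 1 := by
  rw [← stayProb_one hd hγ]
  exact lintegral_mono fun q => limitDensity_mono hd hγ hκ1 le_rfl q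

theorem stayProb_mono (hd : 0 < d) (hγ : 0 < γ) {κ' : ℝ} (h : κ ≤ κ') (hκ' : κ' ≤ 1) :
    stayProb d γ κ ≤ stayProb d γ κ' :=
  lintegral_mono fun q => limitDensity_mono hd hγ h hκ' q

/-- The density at `κ = 1`, of mass one, dominates all others. The limit rate `R` may be infinite,
which covers the degenerate case `κ → 0`. -/
theorem tendsto_stayProb_of_tendsto_limitRate (hd : 0 < d) (hγ : 0 < γ) {ι : Type*} {l : Filter ι}
    [l.IsCountablyGenerated] {k : ι → ℝ} (hk1 : ∀ i, k i ≤ 1)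
    {R : (Fin d → ℝ) → ℝ → ℝ≥0∞}
    (hR : ∀ x h, Tendsto (fun i => limitRate d γ (k i) x h) l (𝓝 (R x h))) :
    Tendsto (fun i => stayProb d γ (k i)) l (𝓝 (∫⁻ q : (Fin d → ℝ) × ℝ,
      ENNReal.ofReal (γ * Real.exp (-γ * q.2)) * expNeg (R q.1 q.2))) := by
  refine tendsto_lintegral_filter_of_dominated_convergence (limitDensity d γ 1)
    (Eventually.of_forall fun i => measurable_limitDensity)
    (Eventually.of_forall fun i => Eventually.of_forall fun q =>
      limitDensity_mono hd hγ (hk1 i) le_rfl q) ?_ (Eventually.of_forall fun q => ?_)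
  · change stayProb d γ 1 ≠ ∞
    rw [stayProb_one hd hγ]
    exact ENNReal.one_ne_top
  · exact ENNReal.Tendsto.const_mul ((continuous_expNeg.tendsto _).comp (hR _ _))
      (Or.inr ENNReal.ofReal_ne_top)

theorem tendsto_stayProb (hd : 0 < d) (hγ : 0 < γ) (hκ : 0 < κ) {ι : Type*} {l : Filter ι}
    [l.IsCountablyGenerated] {k : ι → ℝ} (hk1 : ∀ i, k i ≤ 1) (hk : Tendsto k l (𝓝 κ)) :
    Tendsto (fun i => stayProb d γ (k i)) l (𝓝 (stayProb d γ κ)) :=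
  tendsto_stayProb_of_tendsto_limitRate hd hγ hk1 fun x h => tendsto_limitRate hd hγ hκ hk1 hk x h

theorem tendsto_stayProb_zero (hd : 0 < d) (hγ : 0 < γ) {ι : Type*} {l : Filter ι}
    [l.IsCountablyGenerated] {k : ι → ℝ} (hk1 : ∀ i, k i ≤ 1) (hk : Tendsto k l (𝓝 0)) :
    Tendsto (fun i => stayProb d γ (k i)) l (𝓝 0) := by
  have h := tendsto_stayProb_of_tendsto_limitRate hd hγ hk1
    (R := fun _ _ => ∞) fun x h => tendsto_limitRate_zero hd hγ hk x h
  simpa [expNeg_top] using h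

/-- For slopes of ratio tending to `κ`, the probability that one point beats all others for both
slopes converges. -/
theorem Scaling.tendsto_measure_stays {Ω : Type*} [MeasurableSpace Ω] {P : Measure Ω}
    [IsProbabilityMeasure P] {ξ : (Fin d → ℤ) → Ω → ℝ} {ι : Type*} {l : Filter ι}
    [l.IsCountablyGenerated] [l.NeBot] {r g₀ g₁ : ι → ℝ} (H : Scaling d γ κ l r g₀ g₁)
    (hd : 0 < d) (hγ : 0 < γ) (hκ : 0 < κ) (hκ1 : κ ≤ 1) (hξ : IsIIDWeibull P γ ξ)
    (hone : ∀ i, P (stays ξ (g₀ i) (g₀ i)) = 1) :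
    Tendsto (fun i => P (stays ξ (g₀ i) (g₁ i))) l (𝓝 (stayProb d γ κ)) := by
  have H₀ : Scaling d γ 1 l r g₀ g₀ :=
    { one_lt_r := H.one_lt_r
      g₁_pos := fun i => (H.g₁_pos i).trans_le (H.g₁_le i)
      g₁_le := fun i => le_rfl
      tendsto_r := H.tendsto_r
      tendsto_g₀ := H.tendsto_g₀
      tendsto_g₁ := by simpa using H.tendsto_g₀ }
  have hpt : ∀ {κ' : ℝ} {g' : ι → ℝ}, Scaling d γ κ' l r g₀ g' → 0 < κ' → κ' ≤ 1 →
      ∀ q, Tendsto (fun i => winDensity d γ (r i) (g₀ i) (g' i) q) l (𝓝 (limitDensity d γ κ' q)) := by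
    intro κ' g' H' hκ' hκ'1 q
    have h1 := H'.tendsto_winProb hd hγ hκ' q.1 q.2
    rw [← expNeg_of_ne_top (limitRate_ne_top hd hγ hκ' hκ'1 _ _)] at h1
    have h2 := ENNReal.Tendsto.const_mul h1
      (Or.inr (ENNReal.ofReal_ne_top (r := γ * Real.exp (-γ * q.2))))
    refine h2.congr' ?_
    filter_upwards [(H'.tendsto_log hd).eventually_gt_atTop (-(γ * q.2))] with i hi
    rw [winDensity, if_pos (by linarith)]
  have hint : ∀ g' : ι → ℝ, ∀ i, P (stays ξ (g₀ i) (g' i)) =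
      ∫⁻ q, winDensity d γ (r i) (g₀ i) (g' i) q := fun g' i =>
    measure_stays hd hγ hξ (H.one_lt_r i) _ _
  simp_rw [hint g₁]
  -- The bound is the density for the slope `g₀` alone: its integrals all equal one, and so does the
  -- integral of its limit.
  refine tendsto_lintegral_of_le_of_tendsto
    (g := fun i => winDensity d γ (r i) (g₀ i) (g₀ i)) (g₀ := limitDensity d γ 1)
    (fun i => measurable_winDensity hγ _ _ _) (fun i => measurable_winDensity hγ _ _ _)
    measurable_limitDensity (fun i q => ?_) (hpt H hκ hκ1) (hpt H₀ one_pos le_rfl) ?_ ?_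
  · have hw := winProb_mono hγ (g₀ i) (g₁ i) (latticePoint (r i) q.1)
      (height γ (d * Real.log (r i)) q.2)
    unfold winDensity
    split_ifs
    · gcongr
    · rfl
  · change stayProb d γ 1 ≠ ∞
    rw [stayProb_one hd hγ]
    exact ENNReal.one_ne_top
  · simp_rw [← hint g₀, hone]
    change Tendsto _ _ (𝓝 (stayProb d γ 1))
    rw [stayProb_one hd hγ]
    exact tendsto_const_nhds

end

/-! ### Identification with the ageing integral -/

section
variable {d : ℕ} {γ : ℝ}

theorem lintegral_exp_Ici (hγ : 0 < γ) (b c : ℝ) :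
    ∫⁻ y in Set.Ici b, ENNReal.ofReal (γ * Real.exp (-γ * (y + c))) =
      ENNReal.ofReal (Real.exp (-(γ * (b + c)))) := by
  have h1 : ∀ y : ℝ, γ * Real.exp (-γ * (y + c)) = γ * Real.exp (-γ * c) * Real.exp (-γ * y) :=
    fun y => by rw [mul_assoc, ← Real.exp_add]; ring_nf
  simp_rw [h1]
  have hint : IntegrableOn (fun y : ℝ => Real.exp (-γ * y)) (Set.Ioi b) :=
    integrableOn_exp_mul_Ioi (by linarith) b
  rw [setLIntegral_congr Ioi_ae_eq_Ici.symm, ← ofReal_integral_eq_lintegral_ofReal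
    (hint.const_mul _) (Eventually.of_forall fun y => by positivity), integral_const_mul,
    integral_exp_mul_Ioi (by linarith)]
  congr 1
  rw [neg_div_neg_eq, mul_div_assoc', mul_assoc γ, mul_div_cancel_left₀ _ hγ.ne',
    ← Real.exp_add]
  ring_nf

theorem measurableSet_D (w : ℝ) (x : Fin d → ℝ) (y : ℝ) : MeasurableSet (D d γ w x y) := by
  have hc := (continuous_l1Norm (d := d)).measurable
  exact (measurableSet_le (by fun_prop) (by fun_prop)).union (MeasurableSet.univ.prod measurableSet_Ici)

/-- The fibre of `D` over `x'` is a half-line, whose exponential weight is explicit. The two parts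
of `D` correspond to beating the point `(x, y)` at the later and at the earlier time. -/
theorem nu_D (hd : 0 < d) (hγ : 0 < γ) {w : ℝ} (hw : 0 ≤ w) (x : Fin d → ℝ) (y : ℝ) :
    nu d γ (D d γ w x y) = limitRate d γ (1 / (1 + w)) x (y + theta d γ * l1Norm x) := by
  have hθ := theta_pos hd hγ
  have hc := (continuous_l1Norm (d := d)).measurable
  have hD := measurableSet_D (γ := γ) w x y
  rw [nu, withDensity_apply _ hD, ← lintegral_indicator hD, Measure.volume_eq_prod,
    lintegral_prod _ (Measurable.aemeasurable (Measurable.indicator (by fun_prop) hD)), limitRate]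
  refine lintegral_congr fun x' => ?_
  set k := w * theta d γ / (1 + w) with hk
  set b := y + min (k * (l1Norm x - l1Norm x')) 0 with hb
  have hind : ∀ y' : ℝ, (D d γ w x y).indicator (fun p : (Fin d → ℝ) × ℝ =>
      ENNReal.ofReal (γ * Real.exp (-γ * (p.2 + theta d γ * l1Norm p.1)))) (x', y') =
      (Set.Ici b).indicator (fun y' =>
        ENNReal.ofReal (γ * Real.exp (-γ * (y' + theta d γ * l1Norm x')))) y' := fun y' => by
    have hmem : (x', y') ∈ D d γ w x y ↔ y' ∈ Set.Ici b := by
      have h1 : w * theta d γ * l1Norm x / (1 + w) = k * l1Norm x := by rw [hk]; ring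
      have h2 : w * theta d γ * l1Norm x' / (1 + w) = k * l1Norm x' := by rw [hk]; ring
      simp only [D, Set.mem_union, Set.mem_ofPred_eq, Set.mem_prod, Set.mem_univ, true_and,
        Set.mem_Ici, h1, h2, hb]
      rw [← min_add_add_left, min_le_iff, add_zero]
      refine or_congr_left ?_
      constructor <;> intro h <;> linarith
    by_cases h : y' ∈ Set.Ici b
    · rw [Set.indicator_of_mem h, Set.indicator_of_mem (hmem.2 h)]
    · rw [Set.indicator_of_notMem h, Set.indicator_of_notMem (mt hmem.1 h)]
  simp_rw [hind]
  rw [lintegral_indicator measurableSet_Ici, lintegral_exp_Ici hγ]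
  congr 4
  -- The later slope `θ / (1 + w)` is `θ - k`.
  have h3 : 1 / (1 + w) * theta d γ * (l1Norm x' - l1Norm x) =
      k * (l1Norm x - l1Norm x') + theta d γ * (l1Norm x' - l1Norm x) := by
    rw [hk]
    have : 1 + w ≠ 0 := by positivity
    field_simp
    ring
  rw [h3, hb, min_comm, add_assoc, add_assoc]
  congr 1
  rw [← min_add_add_right, ← min_add_add_left]
  congr 1 <;> ring

theorem ageingIntegral_eq_stayProb (hd : 0 < d) (hγ : 0 < γ) {w : ℝ} (hw : 0 ≤ w) :
    ageingIntegral d γ w = stayProb d γ (1 / (1 + w)) := by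
  have hc := (continuous_l1Norm (d := d)).measurable
  have hmeas := measurable_limitDensity (d := d) (γ := γ) (κ := 1 / (1 + w))
  have hexp : ∀ p : (Fin d → ℝ) × ℝ,
      EReal.exp (-((nu d γ (D d γ w p.1 p.2) : ℝ≥0∞) : EReal)) =
        expNeg (limitRate d γ (1 / (1 + w)) p.1 (p.2 + theta d γ * l1Norm p.1)) := fun p => by
    rw [nu_D hd hγ hw]
    rfl
  have hm : Measurable fun p : (Fin d → ℝ) × ℝ =>
      expNeg (limitRate d γ (1 / (1 + w)) p.1 (p.2 + theta d γ * l1Norm p.1)) :=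
    continuous_expNeg.measurable.comp (measurable_limitRate.comp
      (g := fun q : (Fin d → ℝ) × ℝ => limitRate d γ (1 / (1 + w)) q.1 q.2)
      (f := fun p : (Fin d → ℝ) × ℝ => (p.1, p.2 + theta d γ * l1Norm p.1)) (by fun_prop))
  unfold ageingIntegral
  simp_rw [hexp]
  rw [nu, lintegral_withDensity_eq_lintegral_mul _ (by fun_prop) hm, stayProb,
    lintegral_shear hmeas (theta d γ)]
  rfl

end

/-! ### Deterministic properties of the maximisers -/

/-- The slope of the functional `Ψ_t`. -/
noncomputable def slope (γ t : ℝ) : ℝ := Real.log (Real.log t) / (γ * t)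

theorem Psi_eq {d : ℕ} (γ : ℝ) (f : (Fin d → ℤ) → ℝ) (t : ℝ) (z : Fin d → ℤ) :
    Psi γ f t z = f z - slope γ t * latticeNorm z := by
  unfold Psi slope
  ring

section
variable {d : ℕ} {γ : ℝ} {f : (Fin d → ℤ) → ℝ}

/-- Only finitely many sites have `Ψ_t ≥ 0`, and the origin is one of them, so the maximum over this
finite set is global. -/
theorem exists_isMaximiser (h0 : 0 ≤ f 0)
    (hf : ∀ c : ℝ, 0 < c → {z | c * latticeNorm z ≤ f z}.Finite) {t : ℝ} (ht : 0 < slope γ t) :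
    ∃ z, IsMaximiser γ f t z := by
  have h00 : latticeNorm (0 : Fin d → ℤ) = 0 := by simp [latticeNorm]
  obtain ⟨z, hz, hmax⟩ := Set.exists_max_image _ (Psi γ f t) (hf _ ht)
    ⟨0, by simpa [h00] using h0⟩
  refine ⟨z, fun z' => ?_⟩
  by_cases hz' : slope γ t * latticeNorm z' ≤ f z'
  · exact hmax z' hz'
  · have h1 := hmax 0 (by simpa [h00] using h0)
    rw [Psi_eq, h00] at h1
    rw [Psi_eq γ f t z']
    linarith [not_le.1 hz']

theorem eventually_psi_lt {z z' : Fin d → ℤ} (h : f z < f z')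
    (hlim : Tendsto (slope γ) atTop (𝓝 0)) : ∀ᶠ t in atTop, Psi γ f t z < Psi γ f t z' := by
  have h1 : ∀ y, Tendsto (fun t => Psi γ f t y) atTop (𝓝 (f y)) := fun y => by
    simp_rw [Psi_eq]
    simpa using (tendsto_const_nhds (x := f y)).sub (hlim.mul_const (latticeNorm y))
  exact (h1 z).eventually_lt (h1 z') h

variable {Z : ℝ → Fin d → ℤ} {t : ℝ}

/-- As the slope vanishes, any site with a higher potential eventually overtakes the current one. -/
theorem relocationTime_lt_top (hunb : ∀ M, ∃ z, M < f z)
    (hlim : Tendsto (slope γ) atTop (𝓝 0)) (hZ : ∀ s, t ≤ s → IsMaximiser γ f s (Z s)) :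
    relocationTime Z t < ∞ := by
  obtain ⟨z', hz'⟩ := hunb (f (Z t))
  obtain ⟨u, hu, hut⟩ := ((eventually_psi_lt hz' hlim).and (eventually_gt_atTop t)).exists
  have hmem : 0 < u - t ∧ Z (t + (u - t)) ≠ Z t := by
    refine ⟨by linarith, ?_⟩
    rw [add_sub_cancel]
    intro heq
    have := hZ u hut.le z'
    rw [heq] at this
    linarith
  have hle : relocationTime Z t ≤ ENNReal.ofReal (u - t) := sInf_le ⟨u - t, hmem, rfl⟩
  exact hle.trans_lt ENNReal.ofReal_lt_top

theorem eq_of_lt_relocationTime {s : ℝ} (hs : 0 ≤ s) (h : ENNReal.ofReal s < relocationTime Z t) :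
    Z (t + s) = Z t := by
  rcases hs.eq_or_lt with rfl | hs
  · simp
  by_contra hne
  have hmem : 0 < s ∧ Z (t + s) ≠ Z t := ⟨hs, hne⟩
  have hle : relocationTime Z t ≤ ENNReal.ofReal s := sInf_le ⟨s, hmem, rfl⟩
  exact absurd hle (not_le.2 h)

/-- For a fixed difference of norms the required lead is linear in the slope, so on an interval of
slopes it is at least the minimum over the endpoints. -/
theorem le_add_gap {g₀ g₁ g : ℝ} (h1 : g₁ ≤ g) (h0 : g ≤ g₀) (z z' : Fin d → ℤ) :
    gap g₀ g₁ z z' ≤ g * (latticeNorm z' - latticeNorm z) := by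
  rcases le_total 0 (latticeNorm z' - latticeNorm z) with h | h
  · exact (min_le_right _ _).trans (by gcongr)
  · exact (min_le_left _ _).trans (mul_le_mul_of_nonpos_right h0 h)

/-- If one point beats all others at the times `t` and `t + s`, then there is no relocation
in between. -/
theorem le_relocationTime {s : ℝ} (hs : 0 ≤ s) (hanti : AntitoneOn (slope γ) (Set.Ici t))
    (hZ : ∀ s, t ≤ s → IsMaximiser γ f s (Z s)) {z : Fin d → ℤ}
    (hz : ∀ z', z' ≠ z → f z' < f z + gap (slope γ t) (slope γ (t + s)) z z') :
    ENNReal.ofReal s ≤ relocationTime Z t := by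
  have hfix : ∀ u, t ≤ u → u ≤ t + s → Z u = z := by
    intro u htu hus
    by_contra hne
    have h1 := hz _ hne
    have h2 := hZ u htu z
    rw [Psi_eq, Psi_eq] at h2
    have h3 := le_add_gap (hanti (show t ≤ u from htu) (show t ≤ t + s by linarith) hus)
      (hanti (show t ≤ t from le_rfl) htu htu) z (Z u)
    linarith
  refine le_sInf ?_
  rintro _ ⟨v, ⟨hv, hne⟩, rfl⟩
  refine ENNReal.ofReal_le_ofReal ?_
  by_contra hlt
  exact hne ((hfix _ (by linarith) (by linarith)).trans (hfix t le_rfl (by linarith)).symm)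

theorem beats_of_isMaximiser {u : ℝ} {z : Fin d → ℤ} (h : IsMaximiser γ f t z)
    (h' : IsMaximiser γ f u z)
    (hties : ∀ z z', z ≠ z' → Psi γ f t z ≠ Psi γ f t z')
    (hties' : ∀ z z', z ≠ z' → Psi γ f u z ≠ Psi γ f u z') :
    ∀ z', z' ≠ z → f z' < f z + gap (slope γ t) (slope γ u) z z' := by
  intro z' hne
  have h1 := lt_of_le_of_ne (h z') (hties z' z hne)
  have h2 := lt_of_le_of_ne (h' z') (hties' z' z hne)
  rw [Psi_eq, Psi_eq] at h1 h2
  rw [gap, ← min_add_add_left, lt_min_iff]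
  constructor <;> linarith

end

/-! ### Almost sure properties of the Weibull potential -/

section
variable {Ω : Type*} [MeasurableSpace Ω] {P : Measure Ω} [IsProbabilityMeasure P] {d : ℕ}
  {γ : ℝ} {ξ : (Fin d → ℤ) → Ω → ℝ}

theorem measure_ge (hγ : 0 < γ) (hξ : IsIIDWeibull P γ ξ) (z : Fin d → ℤ) (x : ℝ) :
    P {ω | x ≤ ξ z ω} = ENNReal.ofReal (tail γ x) := by
  have h1 := prob_compl_eq_one_sub (μ := P) ((hξ.measurable z) (measurableSet_Iio (a := x)))
  have h2 : (ξ z ⁻¹' Set.Iio x)ᶜ = {ω | x ≤ ξ z ω} := by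
    ext ω
    simp
  rw [h2, ← Measure.map_apply (hξ.measurable z) measurableSet_Iio, measure_Iio hγ hξ,
    ← ENNReal.ofReal_one, ← ENNReal.ofReal_sub _ (by linarith [tail_le_one γ x])] at h1
  rw [h1]
  congr 1
  ring

theorem ae_nonneg (hγ : 0 < γ) (hξ : IsIIDWeibull P γ ξ) (z : Fin d → ℤ) :
    ∀ᵐ ω ∂P, 0 ≤ ξ z ω := by
  have := measure_ge hγ hξ z 0
  rw [show tail γ 0 = 1 by simp [tail, hγ.ne'], ENNReal.ofReal_one] at this
  exact (prob_compl_eq_zero_iff (measurableSet_le measurable_const (hξ.measurable z))).2 this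

theorem tsum_tail_ne_top (hγ : 0 < γ) {c : ℝ} (hc : 0 < c) :
    ∑' z : Fin d → ℤ, ENNReal.ofReal (tail γ (c * latticeNorm z)) ≠ ∞ := by
  -- The term `c * d` pays for rounding to the lattice; the `1` appears because at `A = 1` the level
  -- is `1 + s`.
  set K := c * d + 1 with hK
  set M := max 1 (Real.exp (-excess γ 1 (-K))) with hM
  rw [tsum_eq_lintegral_latticePoint one_pos, one_pow, ENNReal.ofReal_one, one_mul]
  have hbound : ∀ x : Fin d → ℝ, ENNReal.ofReal (tail γ (c * latticeNorm (latticePoint 1 x))) ≤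
      ENNReal.ofReal M * ENNReal.ofReal (tailBound γ c K x) := fun x => by
    rw [← ENNReal.ofReal_mul (by positivity)]
    refine ENNReal.ofReal_le_ofReal ?_
    have h1 := (abs_le.1 (abs_latticeNorm_latticePoint_sub_le one_pos x)).1
    rw [div_one, div_one] at h1
    have h2 := tail_level (γ := γ) hγ one_pos (c * latticeNorm (latticePoint 1 x) - 1)
    rw [level, Real.one_rpow, Real.one_rpow, one_mul, add_sub_cancel] at h2
    rw [h2]
    calc _ ≤ 1 * Real.exp (-excess γ 1 (c * latticeNorm (latticePoint 1 x) - 1)) := by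
          gcongr
          rw [Real.exp_le_one_iff]
          norm_num
      _ ≤ _ := by
          rw [one_mul]
          refine exp_neg_excess_le hγ le_rfl (le_max_left _ _) x hc.le (le_max_right _ _) ?_
          have : c * (l1Norm x - d) ≤ c * latticeNorm (latticePoint 1 x) := by
            gcongr
            linarith
          linarith
  refine ne_top_of_le_ne_top ?_ (lintegral_mono hbound)
  rw [lintegral_const_mul' _ _ ENNReal.ofReal_ne_top]
  exact ENNReal.mul_ne_top ENNReal.ofReal_ne_top (lintegral_tailBound_lt_top hγ hc).ne

/-- Borel–Cantelli for each of the countably many slopes `1 / (n + 1)`; smaller slopes give larger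
sets. -/
theorem ae_sublinear (hγ : 0 < γ) (hξ : IsIIDWeibull P γ ξ) :
    ∀ᵐ ω ∂P, ∀ c : ℝ, 0 < c → {z | c * latticeNorm z ≤ ξ z ω}.Finite := by
  have h1 : ∀ n : ℕ, ∀ᵐ ω ∂P, {z | 1 / ((n : ℝ) + 1) * latticeNorm z ≤ ξ z ω}.Finite := fun n => by
    refine ae_finite_setOfPred_mem (s := fun z => {ω | 1 / ((n : ℝ) + 1) * latticeNorm z ≤ ξ z ω}) ?_
    simp_rw [measure_ge hγ hξ]
    exact tsum_tail_ne_top hγ (by positivity)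
  filter_upwards [ae_all_iff.2 h1] with ω hω c hc
  obtain ⟨n, hn⟩ := exists_nat_one_div_lt hc
  refine (hω n).subset fun z (hz : c * latticeNorm z ≤ ξ z ω) => ?_
  change 1 / ((n : ℝ) + 1) * latticeNorm z ≤ ξ z ω
  refine le_trans ?_ hz
  exact mul_le_mul_of_nonneg_right hn.le (latticeNorm_nonneg z)

theorem ae_unbounded (hd : 0 < d) (hγ : 0 < γ) (hξ : IsIIDWeibull P γ ξ) :
    ∀ᵐ ω ∂P, ∀ M : ℝ, ∃ z, M < ξ z ω := by
  have : Nonempty (Fin d) := ⟨⟨0, hd⟩⟩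
  have h1 : ∀ n : ℕ, ∀ᵐ ω ∂P, ∃ z, (n : ℝ) ≤ ξ z ω := fun n => by
    have hp : ENNReal.ofReal (1 - tail γ n) < 1 := by
      rw [ENNReal.ofReal_lt_one]
      linarith [tail_pos γ n]
    have hle : ∀ k : ℕ, P {ω | ¬ ∃ z, (n : ℝ) ≤ ξ z ω} ≤ ENNReal.ofReal (1 - tail γ n) ^ k := by
      intro k
      obtain ⟨F, hF⟩ := Infinite.exists_subset_card_eq (Fin d → ℤ) k
      have h2 := hξ.indep.measure_inter_preimage_eq_mul F (sets := fun _ => Set.Iio (n : ℝ))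
        fun _ _ => measurableSet_Iio
      have h3 : ∀ z, P (ξ z ⁻¹' Set.Iio (n : ℝ)) = ENNReal.ofReal (1 - tail γ n) := fun z => by
        rw [← Measure.map_apply (hξ.measurable z) measurableSet_Iio, measure_Iio hγ hξ]
      simp_rw [h3] at h2
      rw [Finset.prod_const, hF] at h2
      rw [← h2]
      refine measure_mono fun ω hω => ?_
      simp only [Set.mem_iInter]
      intro z _
      exact not_le.1 fun h => hω ⟨z, h⟩
    exact le_antisymm (ge_of_tendsto' (ENNReal.tendsto_pow_atTop_nhds_zero_of_lt_one hp) hle) zero_le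
  filter_upwards [ae_all_iff.2 h1] with ω hω M
  obtain ⟨n, hn⟩ := exists_nat_gt M
  obtain ⟨z, hz⟩ := hω n
  exact ⟨z, hn.trans_le hz⟩

theorem ae_no_ties (hγ : 0 < γ) (hξ : IsIIDWeibull P γ ξ) (t : ℝ) :
    ∀ᵐ ω ∂P, ∀ z z', z ≠ z' → Psi γ (fun z' => ξ z' ω) t z ≠ Psi γ (fun z' => ξ z' ω) t z' := by
  rw [ae_all_iff]
  intro z
  rw [ae_all_iff]
  intro z'
  by_cases hne : z = z'
  · simp [hne]
  set c := slope γ t * latticeNorm z - slope γ t * latticeNorm z' with hc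
  have hind := (indepFun_iff_map_prod_eq_prod_map_map (hξ.measurable z).aemeasurable
    (hξ.measurable z').aemeasurable).1 (hξ.indep.indepFun hne)
  have hB : MeasurableSet {q : ℝ × ℝ | q.1 = q.2 + c} :=
    measurableSet_eq_fun (by fun_prop) (by fun_prop)
  have := nullSingletonClass_map hγ hξ z'
  have := Measure.isProbabilityMeasure_map (μ := P) (hξ.measurable z').aemeasurable
  have h0 : (P.map (ξ z)).prod (P.map (ξ z')) {q : ℝ × ℝ | q.1 = q.2 + c} = 0 := by
    rw [Measure.measure_prod_null hB]
    refine Eventually.of_forall fun a => ?_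
    have : Prod.mk a ⁻¹' {q : ℝ × ℝ | q.1 = q.2 + c} = {a - c} := by
      ext b
      simp only [Set.mem_preimage, Set.mem_ofPred_eq, Set.mem_singleton_iff]
      constructor <;> intro h <;> linarith
    simp only [this, measure_singleton, Pi.zero_apply]
  rw [← hind, Measure.map_apply ((hξ.measurable z).prodMk (hξ.measurable z')) hB] at h0
  refine measure_mono_null (fun ω hω => ?_) h0
  simp only [Set.mem_compl_iff, Set.mem_ofPred_eq, ne_eq, hne, not_false_iff, true_implies,
    not_not, Psi_eq] at hω
  simp only [Set.mem_preimage, Set.mem_ofPred_eq]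
  linarith

theorem ae_exists_isMaximiser (hγ : 0 < γ) (hξ : IsIIDWeibull P γ ξ) :
    ∀ᵐ ω ∂P, ∀ t, 0 < slope γ t → ∃ z, IsMaximiser γ (fun z' => ξ z' ω) t z := by
  filter_upwards [ae_sublinear hγ hξ, ae_nonneg hγ hξ 0] with ω h1 h2 t ht
  exact exists_isMaximiser h2 h1 ht

/-- This fixes the mass of the dominating densities at one: a maximiser exists, and without ties it
wins strictly. -/
theorem measure_stays_self (hγ : 0 < γ) (hξ : IsIIDWeibull P γ ξ) {t : ℝ} (ht : 0 < slope γ t) :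
    P (stays ξ (slope γ t) (slope γ t)) = 1 := by
  rw [← prob_compl_eq_zero_iff (measurableSet_stays hξ.measurable _ _)]
  have h : ∀ᵐ ω ∂P, ω ∈ stays ξ (slope γ t) (slope γ t) := by
    filter_upwards [ae_exists_isMaximiser hγ hξ, ae_no_ties hγ hξ t] with ω h1 h2
    obtain ⟨z, hz⟩ := h1 t ht
    exact Set.mem_iUnion.2 ⟨z, beats_of_isMaximiser hz hz h2 h2⟩
  exact h

end

/-! ### The scales of the problem -/

theorem exp_one_le_log_of_exp_exp_le {t : ℝ} (ht : Real.exp (Real.exp 1) ≤ t) :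
    Real.exp 1 ≤ Real.log t :=
  (Real.le_log_iff_exp_le ((Real.exp_pos _).trans_le ht)).2 ht

theorem slope_pos {γ t : ℝ} (hγ : 0 < γ) (ht : Real.exp (Real.exp 1) ≤ t) : 0 < slope γ t := by
  have h1 := exp_one_le_log_of_exp_exp_le ht
  have h2 : 0 < t := (Real.exp_pos _).trans_le ht
  have h3 : 0 < Real.log (Real.log t) :=
    Real.log_pos ((Real.one_lt_exp_iff.2 one_pos).trans_le h1)
  unfold slope
  positivity

theorem slope_eq {γ t : ℝ} (ht : Real.log t ≠ 0) :
    slope γ t = Real.log (Real.log t) / Real.log t * (Real.log t / t) / γ := by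
  unfold slope
  rcases eq_or_ne t 0 with rfl | h
  · simp
  rw [div_mul_div_cancel₀ ht, div_div, mul_comm γ]

/-- Up to `1 / γ` the slope is the product of `log u / u` at `u = t` and at `u = log t`, both
nonnegative and decreasing once `u ≥ e`. -/
theorem slope_antitoneOn {γ : ℝ} (hγ : 0 < γ) :
    AntitoneOn (slope γ) (Set.Ici (Real.exp (Real.exp 1))) := by
  intro s (hs : _ ≤ s) t (ht : _ ≤ t) hst
  have hs1 := exp_one_le_log_of_exp_exp_le hs
  have ht1 := exp_one_le_log_of_exp_exp_le ht
  have he : 0 < Real.exp 1 := Real.exp_pos 1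
  have hs0 : 0 < s := (Real.exp_pos _).trans_le hs
  have ht0 : 0 < t := (Real.exp_pos _).trans_le ht
  have hee : Real.exp 1 ≤ Real.exp (Real.exp 1) :=
    Real.exp_le_exp.2 (Real.one_lt_exp_iff.2 one_pos).le
  rw [slope_eq (he.trans_le hs1).ne', slope_eq (he.trans_le ht1).ne']
  have h1 := Real.log_div_self_antitoneOn (show Real.exp 1 ≤ s from hee.trans hs)
    (show Real.exp 1 ≤ t from hee.trans ht) hst
  have h2 := Real.log_div_self_antitoneOn (show Real.exp 1 ≤ Real.log s from hs1)
    (show Real.exp 1 ≤ Real.log t from ht1) (Real.log_le_log hs0 hst)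
  have h3 : 0 ≤ Real.log (Real.log s) / Real.log s :=
    div_nonneg (Real.log_nonneg ((Real.one_le_exp zero_le_one).trans hs1)) (he.le.trans hs1)
  have h4 : 0 ≤ Real.log t / t := div_nonneg (he.le.trans ht1) ht0.le
  simp only at h1 h2
  gcongr

theorem tendsto_log_div_self : Tendsto (fun t : ℝ => Real.log t / t) atTop (𝓝 0) :=
  Real.isLittleO_log_id_atTop.tendsto_div_nhds_zero

theorem tendsto_slope (γ : ℝ) : Tendsto (slope γ) atTop (𝓝 0) := by
  have h := (((tendsto_log_div_self.comp Real.tendsto_log_atTop).mul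
    tendsto_log_div_self).div_const γ)
  rw [zero_mul, zero_div] at h
  refine h.congr' ?_
  filter_upwards [Real.tendsto_log_atTop.eventually_gt_atTop 0] with t ht
  exact (slope_eq ht.ne').symm

/-- The spatial scale of the maximisers of `Ψ_t`. -/
noncomputable def spaceScale (γ t : ℝ) : ℝ :=
  t * Real.log t ^ (1 / γ - 1) / Real.log (Real.log t)

theorem tendsto_log_spaceScale_div (γ : ℝ) :
    Tendsto (fun t => Real.log (spaceScale γ t) / Real.log t) atTop (𝓝 1) := by
  have hu := Real.tendsto_log_atTop
  have hv : Tendsto (fun t => Real.log (Real.log t)) atTop atTop := hu.comp hu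
  have h1 := tendsto_log_div_self.comp hu
  have h2 := tendsto_log_div_self.comp hv
  have h3 : Tendsto (fun t => 1 + (1 / γ - 1) * (Real.log (Real.log t) / Real.log t) -
      Real.log (Real.log (Real.log t)) / Real.log (Real.log t) *
        (Real.log (Real.log t) / Real.log t)) atTop (𝓝 (1 + (1 / γ - 1) * 0 - 0 * 0)) :=
    (tendsto_const_nhds.add (h1.const_mul _)).sub (h2.mul h1)
  simp only [mul_zero, add_zero, sub_zero] at h3
  refine h3.congr' ?_
  filter_upwards [eventually_gt_atTop 0, hu.eventually_gt_atTop 0, hv.eventually_gt_atTop 0]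
    with t h0 hut hvt
  rw [spaceScale, Real.log_div (by positivity) hvt.ne', Real.log_mul h0.ne' (by positivity),
    Real.log_rpow hut]
  field_simp

theorem tendsto_log_spaceScale (γ : ℝ) :
    Tendsto (fun t => Real.log (spaceScale γ t)) atTop atTop := by
  have h := (tendsto_log_spaceScale_div γ).pos_mul_atTop one_pos Real.tendsto_log_atTop
  refine h.congr' ?_
  filter_upwards [Real.tendsto_log_atTop.eventually_gt_atTop 0] with t ht
  exact div_mul_cancel₀ _ ht.ne'

theorem spaceScale_pos {γ : ℝ} : ∀ᶠ t in atTop, 0 < spaceScale γ t := by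
  have hu := Real.tendsto_log_atTop
  filter_upwards [eventually_gt_atTop 0, hu.eventually_gt_atTop 0,
    (hu.comp hu).eventually_gt_atTop 0] with t h0 hut (hvt : 0 < Real.log (Real.log t))
  unfold spaceScale
  positivity

theorem tendsto_spaceScale (γ : ℝ) : Tendsto (spaceScale γ) atTop atTop := by
  refine (Real.tendsto_exp_atTop.comp (tendsto_log_spaceScale γ)).congr' ?_
  filter_upwards [spaceScale_pos] with t ht
  exact Real.exp_log ht

/-- The scale is chosen so that slope times scale is `γ⁻¹ (log t)^{1/γ-1}`. Since `log r ~ log t`,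
dividing by `(d log r)^{1/γ-1}` leaves `γ⁻¹ d^{1-1/γ} = θ`. -/
theorem tendsto_slope_mul_spaceScale {d : ℕ} (hd : 0 < d) {γ : ℝ} (hγ : 0 < γ) :
    Tendsto (fun t => slope γ t * spaceScale γ t /
      (d * Real.log (spaceScale γ t)) ^ (1 / γ - 1)) atTop (𝓝 (theta d γ)) := by
  have hu := Real.tendsto_log_atTop
  have hd' : (0 : ℝ) < d := by positivity
  have h1 : Tendsto (fun t => γ⁻¹ * (d * (Real.log (spaceScale γ t) / Real.log t)) ^ (1 - 1 / γ))
      atTop (𝓝 (γ⁻¹ * (d * 1) ^ (1 - 1 / γ))) :=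
    (((tendsto_log_spaceScale_div γ).const_mul (d : ℝ)).rpow_const
      (Or.inl (by positivity))).const_mul γ⁻¹
  rw [mul_one] at h1
  refine h1.congr' ?_
  filter_upwards [eventually_gt_atTop 0, hu.eventually_gt_atTop 0,
    (hu.comp hu).eventually_gt_atTop 0, (tendsto_log_spaceScale γ).eventually_gt_atTop 0]
    with t h0 hut (hvt : 0 < Real.log (Real.log t)) hr
  have h2 : slope γ t * spaceScale γ t = γ⁻¹ * Real.log t ^ (1 / γ - 1) := by
    rw [slope, spaceScale]
    field_simp
  rw [h2, mul_div_assoc' (d : ℝ), Real.div_rpow (by positivity) hut.le,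
    show 1 - 1 / γ = -(1 / γ - 1) by ring, Real.rpow_neg (by positivity), Real.rpow_neg hut.le]
  have : 0 < (d * Real.log (spaceScale γ t)) ^ (1 / γ - 1) := by positivity
  have : 0 < Real.log t ^ (1 / γ - 1) := by positivity
  field_simp

/-- The iterated logarithm does not feel the factor `1 + w`, so only the ratio of the times
survives. -/
theorem tendsto_slope_ratio {γ : ℝ} (hγ : 0 < γ) {w : ℝ} (hw : 0 ≤ w) :
    Tendsto (fun t => slope γ (t + w * t) / slope γ t) atTop (𝓝 (1 / (1 + w))) := by
  have hu := Real.tendsto_log_atTop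
  have hv : Tendsto (fun t => Real.log (Real.log t)) atTop atTop := hu.comp hu
  have hw1 : 0 < 1 + w := by positivity
  have h1 : Tendsto (fun t => Real.log (1 + Real.log (1 + w) / Real.log t)) atTop (𝓝 0) := by
    have h2 : Tendsto (fun t => 1 + Real.log (1 + w) / Real.log t) atTop (𝓝 (1 + 0)) :=
      tendsto_const_nhds.add (tendsto_const_nhds.div_atTop hu)
    rw [add_zero] at h2
    simpa using h2.log one_ne_zero
  have h3 : Tendsto (fun t => (1 + Real.log (1 + Real.log (1 + w) / Real.log t) /
      Real.log (Real.log t)) * (1 / (1 + w))) atTop (𝓝 ((1 + 0) * (1 / (1 + w)))) :=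
    (tendsto_const_nhds.add (h1.div_atTop hv)).mul_const _
  rw [add_zero, one_mul] at h3
  refine h3.congr' ?_
  filter_upwards [eventually_gt_atTop 0, hu.eventually_gt_atTop 0, hv.eventually_gt_atTop 0]
    with t h0 hut hvt
  have hc : 0 ≤ Real.log (1 + w) := Real.log_nonneg (by linarith)
  have h4 : Real.log (t + w * t) = Real.log t * (1 + Real.log (1 + w) / Real.log t) := by
    rw [show t + w * t = (1 + w) * t by ring, Real.log_mul hw1.ne' h0.ne']
    field_simp
    ring
  rw [slope, slope, h4, Real.log_mul hut.ne' (by positivity)]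
  have h5 : t + w * t = (1 + w) * t := by ring
  rw [h5]
  field_simp

/-- Times are restricted to a half-line because the inequalities in `Scaling` are required at every
index. One half-line serves all `w`, as a single index set is needed for convergence in
distribution. -/
theorem exists_scaling {d : ℕ} (hd : 0 < d) {γ : ℝ} (hγ : 0 < γ) :
    ∃ t₁ : ℝ, Real.exp (Real.exp 1) ≤ t₁ ∧ ∀ t₀, t₁ ≤ t₀ → ∀ w : ℝ, 0 ≤ w →
      Scaling d γ (1 / (1 + w)) (atTop : Filter (Set.Ioi t₀)) (fun t => spaceScale γ t)
        (fun t => slope γ t) (fun t => slope γ (t + w * t)) := by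
  obtain ⟨t₂, ht₂⟩ := ((tendsto_spaceScale γ).eventually_gt_atTop 1).exists_forall_of_atTop
  refine ⟨max (Real.exp (Real.exp 1)) t₂, le_max_left _ _, fun t₀ ht₀ w hw => ?_⟩
  have hge : ∀ t : Set.Ioi t₀, Real.exp (Real.exp 1) ≤ (t : ℝ) := fun t =>
    ((le_max_left _ _).trans ht₀).trans (le_of_lt t.2)
  have hle : ∀ t : Set.Ioi t₀, (t : ℝ) ≤ t + w * t := fun t => by
    have := mul_nonneg hw ((Real.exp_pos _).le.trans (hge t))
    linarith
  have hval : Tendsto (fun t : Set.Ioi t₀ => (t : ℝ)) atTop atTop :=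
    tendsto_Ioi_atTop.1 tendsto_id
  refine ⟨fun t => ht₂ t (((le_max_right _ _).trans ht₀).trans (le_of_lt t.2)),
    fun t => slope_pos hγ ((hge t).trans (hle t)),
    fun t => slope_antitoneOn hγ (hge t) ((hge t).trans (hle t)) (hle t),
    (tendsto_spaceScale γ).comp hval, (tendsto_slope_mul_spaceScale hd hγ).comp hval, ?_⟩
  refine (((tendsto_slope_ratio hγ hw).mul (tendsto_slope_mul_spaceScale hd hγ)).comp hval).congr
    fun t => ?_
  have := (slope_pos hγ (hge t)).ne'
  simp only [Function.comp]
  field_simp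

/-! ### The limit law -/

/-- The ratio of the slopes at the times `t + w t` and `t`, in the limit `t → ∞`. -/
noncomputable def ratio (w : ℝ) : ℝ := 1 / (1 + max w 0)

theorem ratio_pos (w : ℝ) : 0 < ratio w := by
  have := le_max_right w 0
  unfold ratio
  positivity

theorem ratio_le_one (w : ℝ) : ratio w ≤ 1 := by
  have := le_max_right w 0
  rw [ratio, div_le_one (by linarith)]
  linarith

theorem continuous_ratio : Continuous ratio := by
  unfold ratio
  refine continuous_const.div (by fun_prop) fun w => ?_
  have := le_max_right w 0
  positivity

theorem ratio_antitone : Antitone ratio := fun v w h => by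
  unfold ratio
  have := le_max_right v 0
  gcongr

theorem tendsto_ratio_atTop : Tendsto ratio atTop (𝓝 0) := by
  have h : Tendsto (fun w : ℝ => 1 + max w 0) atTop atTop :=
    tendsto_atTop_add_const_left _ _ (tendsto_atTop_mono (fun w => le_max_left w 0) tendsto_id)
  exact tendsto_const_nhds.div_atTop h

theorem ratio_of_nonneg {w : ℝ} (hw : 0 ≤ w) : ratio w = 1 / (1 + w) := by
  rw [ratio, max_eq_left hw]

section
variable {d : ℕ} {γ : ℝ}

theorem continuous_stayProb_ratio (hd : 0 < d) (hγ : 0 < γ) :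
    Continuous fun w => stayProb d γ (ratio w) :=
  continuous_iff_continuousAt.2 fun w =>
    tendsto_stayProb hd hγ (ratio_pos w) ratio_le_one (continuous_ratio.tendsto w)

theorem stayProb_ratio_ne_top (hd : 0 < d) (hγ : 0 < γ) (w : ℝ) : stayProb d γ (ratio w) ≠ ∞ :=
  ne_top_of_le_ne_top ENNReal.one_ne_top (stayProb_le_one hd hγ (ratio_le_one w))

theorem continuous_toReal_stayProb_ratio (hd : 0 < d) (hγ : 0 < γ) :
    Continuous fun w => (stayProb d γ (ratio w)).toReal :=
  continuous_iff_continuousAt.2 fun w => (ENNReal.tendsto_toReal (stayProb_ratio_ne_top hd hγ w)).comp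
    ((continuous_stayProb_ratio hd hγ).tendsto w)

/-- The distribution function of the limit law. -/
noncomputable def limitCdf (hd : 0 < d) (hγ : 0 < γ) : StieltjesFunction ℝ where
  toFun w := 1 - (stayProb d γ (ratio w)).toReal
  mono' v w h := by
    have := ENNReal.toReal_mono (stayProb_ratio_ne_top hd hγ v)
      (stayProb_mono hd hγ (ratio_antitone h) (ratio_le_one v))
    simp only
    linarith
  right_continuous' w :=
    (continuous_const.sub (continuous_toReal_stayProb_ratio hd hγ)).continuousWithinAt

theorem limitCdf_apply (hd : 0 < d) (hγ : 0 < γ) (w : ℝ) :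
    limitCdf hd hγ w = 1 - (stayProb d γ (ratio w)).toReal := rfl

theorem limitCdf_of_nonpos (hd : 0 < d) (hγ : 0 < γ) {w : ℝ} (hw : w ≤ 0) :
    limitCdf hd hγ w = 0 := by
  rw [limitCdf_apply, ratio, max_eq_right hw, add_zero, div_one, stayProb_one hd hγ]
  simp

theorem tendsto_limitCdf_atBot (hd : 0 < d) (hγ : 0 < γ) :
    Tendsto (limitCdf hd hγ) atBot (𝓝 0) := by
  refine tendsto_const_nhds.congr' ?_
  filter_upwards [eventually_le_atBot 0] with w hw
  exact (limitCdf_of_nonpos hd hγ hw).symm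

/-- No mass is lost at infinity: as `w → ∞` the competing rate diverges and the chance of staying
vanishes. -/
theorem tendsto_limitCdf_atTop (hd : 0 < d) (hγ : 0 < γ) :
    Tendsto (limitCdf hd hγ) atTop (𝓝 1) := by
  have h := (ENNReal.tendsto_toReal ENNReal.zero_ne_top).comp
    (tendsto_stayProb_zero hd hγ ratio_le_one tendsto_ratio_atTop)
  have h2 := (tendsto_const_nhds (x := (1 : ℝ))).sub h
  rw [ENNReal.toReal_zero, sub_zero] at h2
  exact h2

theorem isProbabilityMeasure_limitCdf (hd : 0 < d) (hγ : 0 < γ) :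
    IsProbabilityMeasure (limitCdf hd hγ).measure :=
  (limitCdf hd hγ).isProbabilityMeasure (tendsto_limitCdf_atBot hd hγ)
    (tendsto_limitCdf_atTop hd hγ)

theorem measure_Iic_limitCdf (hd : 0 < d) (hγ : 0 < γ) (w : ℝ) :
    (limitCdf hd hγ).measure (Set.Iic w) = ENNReal.ofReal (limitCdf hd hγ w) := by
  rw [StieltjesFunction.measure_Iic _ (tendsto_limitCdf_atBot hd hγ), sub_zero]

theorem measure_singleton_limitCdf (hd : 0 < d) (hγ : 0 < γ) (w : ℝ) :
    (limitCdf hd hγ).measure {w} = 0 := by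
  have hc : Continuous (limitCdf hd hγ) :=
    continuous_const.sub (continuous_toReal_stayProb_ratio hd hγ)
  rw [StieltjesFunction.measure_singleton, hc.continuousWithinAt.leftLim_eq, sub_self,
    ENNReal.ofReal_zero]

end

/-! ### Convergence in distribution of the relocation time -/

theorem measureReal_map_Ioc {Ω : Type*} [MeasurableSpace Ω] {P : Measure Ω}
    [IsProbabilityMeasure P] {X : Ω → ℝ} (hX : AEMeasurable X P) {a b : ℝ} (hab : a ≤ b) :
    (P.map X).real (Set.Ioc a b) = P.real {ω | X ω ≤ b} - P.real {ω | X ω ≤ a} := by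
  have := Measure.isProbabilityMeasure_map hX
  have h1 : ∀ c, P.real {ω | X ω ≤ c} = (P.map X).real (Set.Iic c) := fun c => by
    rw [map_measureReal_apply_of_aemeasurable hX measurableSet_Iic]
    rfl
  rw [h1, h1, ← measureReal_sdiff (Set.Iic_subset_Iic.2 hab) measurableSet_Iic, Set.Iic_sdiff_Iic]

/-- Convergence of the distribution functions at every point implies convergence in distribution. -/
theorem tendstoInDistribution_of_tendsto_measure_le {ι Ω Ω' : Type*} [MeasurableSpace Ω]
    [MeasurableSpace Ω'] {P : Measure Ω} [IsProbabilityMeasure P] {P' : Measure Ω'}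
    [IsProbabilityMeasure P'] {l : Filter ι} [l.IsCountablyGenerated] {X : ι → Ω → ℝ} {Y : Ω' → ℝ}
    (hX : ∀ i, AEMeasurable (X i) P) (hY : AEMeasurable Y P')
    (h : ∀ a, Tendsto (fun i => P.real {ω | X i ω ≤ a}) l (𝓝 (P'.real {ω | Y ω ≤ a}))) :
    TendstoInDistribution X l Y (fun _ => P) P' := by
  refine ⟨hX, hY, ?_⟩
  -- Half-open intervals form a π-system that contains small neighbourhoods of every point, and
  -- their probabilities are differences of distribution functions.
  let S : Set (Set ℝ) := {s | ∃ a b, s = Set.Ioc a b}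
  have hS : IsPiSystem S := by
    rintro _ ⟨a, b, rfl⟩ _ ⟨a', b', rfl⟩ _
    exact ⟨_, _, Set.Ioc_inter_Ioc⟩
  refine hS.tendsto_probabilityMeasure_of_tendsto_of_mem ?_ ?_ ?_
  · rintro _ ⟨a, b, rfl⟩
    exact measurableSet_Ioc
  · intro u hu x hx
    obtain ⟨ε, hε, hball⟩ := Metric.isOpen_iff.1 hu x hx
    refine ⟨Set.Ioc (x - ε / 2) (x + ε / 2), ⟨_, _, rfl⟩, Ioc_mem_nhds (by linarith) (by linarith),
      fun y hy => hball ?_⟩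
    rw [Metric.mem_ball, Real.dist_eq, abs_lt]
    constructor <;> linarith [hy.1, hy.2]
  · rintro _ ⟨a, b, rfl⟩
    rcases le_total b a with hab | hab
    · simp [Set.Ioc_eq_empty_of_le hab, tendsto_const_nhds]
    rw [← NNReal.tendsto_coe]
    change Tendsto (fun i => (P.map (X i)).real (Set.Ioc a b)) l
      (𝓝 ((P'.map Y).real (Set.Ioc a b)))
    simp_rw [measureReal_map_Ioc (hX _) hab, measureReal_map_Ioc hY hab]
    exact (h b).sub (h a)

section
variable {Ω : Type*} [MeasurableSpace Ω] {P : Measure Ω} [IsProbabilityMeasure P] {d : ℕ}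
  {γ : ℝ} {ξ : (Fin d → ℤ) → Ω → ℝ} {Z : ℝ → Ω → Fin d → ℤ} {t : ℝ}

/-- The event that one point beats all others at the times `t` and `t + s`, and the event that
there is no relocation between these times, coincide up to the boundary case. -/
theorem ae_stays_iff (hγ : 0 < γ) (hξ : IsIIDWeibull P γ ξ) (ht : Real.exp (Real.exp 1) ≤ t)
    (hZ : ∀ s, t ≤ s → ∀ ω, (∃ z, IsMaximiser γ (fun z' => ξ z' ω) s z) →
      IsMaximiser γ (fun z' => ξ z' ω) s (Z s ω)) {s : ℝ} (hs : 0 ≤ s) :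
    ∀ᵐ ω ∂P, (ω ∈ stays ξ (slope γ t) (slope γ (t + s)) →
        ENNReal.ofReal s ≤ relocationTime (fun s => Z s ω) t) ∧
      (ENNReal.ofReal s < relocationTime (fun s => Z s ω) t →
        ω ∈ stays ξ (slope γ t) (slope γ (t + s))) := by
  filter_upwards [ae_exists_isMaximiser hγ hξ, ae_no_ties hγ hξ t, ae_no_ties hγ hξ (t + s)]
    with ω h1 h2 h3
  have hmax : ∀ u, t ≤ u → IsMaximiser γ (fun z' => ξ z' ω) u (Z u ω) := fun u hu =>
    hZ u hu ω (h1 u (slope_pos hγ (ht.trans hu)))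
  constructor
  · intro h
    obtain ⟨z, hz⟩ := Set.mem_iUnion.1 h
    exact le_relocationTime hs ((slope_antitoneOn hγ).mono (Set.Ici_subset_Ici.2 ht)) hmax hz
  · intro h
    have heq : Z (t + s) ω = Z t ω := eq_of_lt_relocationTime hs h
    have h4 := hmax (t + s) (by linarith)
    rw [heq] at h4
    exact Set.mem_iUnion.2 ⟨Z t ω, beats_of_isMaximiser (hmax t le_rfl) h4 h2 h3⟩

theorem ae_relocationTime_lt_top (hd : 0 < d) (hγ : 0 < γ) (hξ : IsIIDWeibull P γ ξ)
    (ht : Real.exp (Real.exp 1) ≤ t)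
    (hZ : ∀ s, t ≤ s → ∀ ω, (∃ z, IsMaximiser γ (fun z' => ξ z' ω) s z) →
      IsMaximiser γ (fun z' => ξ z' ω) s (Z s ω)) :
    ∀ᵐ ω ∂P, relocationTime (fun s => Z s ω) t < ∞ := by
  filter_upwards [ae_exists_isMaximiser hγ hξ, ae_unbounded hd hγ hξ] with ω h1 h2
  exact relocationTime_lt_top (f := fun z => ξ z ω) h2 (tendsto_slope γ) fun u hu =>
    hZ u hu ω (h1 u (slope_pos hγ (ht.trans hu)))

/-- Nothing is assumed about the measurability of `Z`. Almost surely the relocation time is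
recovered from the measurable events `stays` as a supremum over rational durations. -/
theorem aemeasurable_relocationTime (hγ : 0 < γ) (hξ : IsIIDWeibull P γ ξ)
    (ht : Real.exp (Real.exp 1) ≤ t)
    (hZ : ∀ s, t ≤ s → ∀ ω, (∃ z, IsMaximiser γ (fun z' => ξ z' ω) s z) →
      IsMaximiser γ (fun z' => ξ z' ω) s (Z s ω)) :
    AEMeasurable (fun ω => relocationTime (fun s => Z s ω) t) P := by
  let E : ℚ → Set Ω := fun q => stays ξ (slope γ t) (slope γ (t + q))
  let T : Ω → ℝ≥0∞ := fun ω => ⨆ q : {q : ℚ // 0 ≤ q},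
    (E q).indicator (fun _ => ENNReal.ofReal q) ω
  have hT : Measurable T := Measurable.iSup fun q =>
    measurable_const.indicator (measurableSet_stays hξ.measurable _ _)
  refine ⟨T, hT, ?_⟩
  have hall : ∀ᵐ ω ∂P, ∀ q : {q : ℚ // 0 ≤ q}, _ := ae_all_iff.2 fun q : {q : ℚ // 0 ≤ q} =>
    ae_stays_iff hγ hξ ht hZ (s := (q : ℚ)) (by exact_mod_cast q.2)
  filter_upwards [hall] with ω hω
  refine le_antisymm (le_of_forall_lt fun c hc => ?_) (iSup_le fun q => ?_)
  · obtain ⟨q, hq0, hcq, hqT⟩ := ENNReal.lt_iff_exists_rat_btwn.1 hc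
    have hmem := (hω ⟨q, hq0⟩).2 hqT
    refine hcq.trans_le (le_trans ?_ (le_iSup _ (⟨q, hq0⟩ : {q : ℚ // 0 ≤ q})))
    rw [Set.indicator_of_mem hmem]
    rfl
  · by_cases h : ω ∈ E q
    · rw [Set.indicator_of_mem h]
      exact (hω q).1 h
    · rw [Set.indicator_of_notMem h]
      exact zero_le

/-- The event lies inside the staying event for `w` and, up to null sets, contains the one for every
`v > w`. Continuity of the limit in `w` closes the gap left by the boundary case. -/
theorem tendsto_measure_relocationTime_gt (hd : 0 < d) (hγ : 0 < γ) (hξ : IsIIDWeibull P γ ξ)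
    {t₀ : ℝ} (ht₀ : Real.exp (Real.exp 1) ≤ t₀)
    (hscal : ∀ w : ℝ, 0 ≤ w → Scaling d γ (1 / (1 + w)) (atTop : Filter (Set.Ioi t₀))
      (fun t => spaceScale γ t) (fun t => slope γ t) (fun t => slope γ (t + w * t)))
    (hZ : ∀ s, t₀ ≤ s → ∀ ω, (∃ z, IsMaximiser γ (fun z' => ξ z' ω) s z) →
      IsMaximiser γ (fun z' => ξ z' ω) s (Z s ω)) {w : ℝ} (hw : 0 ≤ w) :
    Tendsto (fun t : Set.Ioi t₀ =>
      P {ω | w < (relocationTime (fun s => Z s ω) (t : ℝ)).toReal / (t : ℝ)}) atTop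
      (𝓝 (stayProb d γ (ratio w))) := by
  have htpos : ∀ t : Set.Ioi t₀, (0 : ℝ) < t := fun t => (Real.exp_pos _).trans_le (ht₀.trans t.2.le)
  have hlim : ∀ v : ℝ, 0 ≤ v → Tendsto (fun t : Set.Ioi t₀ =>
      P (stays ξ (slope γ t) (slope γ (t + v * t)))) atTop (𝓝 (stayProb d γ (ratio v))) := by
    intro v hv
    have := (hscal v hv).tendsto_measure_stays (P := P) (ξ := ξ) hd hγ (by positivity)
      (by rw [div_le_one (by positivity)]; linarith) hξ
      fun t => measure_stays_self hγ hξ (slope_pos hγ (ht₀.trans t.2.le))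
    rwa [ratio_of_nonneg hv]
  have hiff : ∀ t : Set.Ioi t₀, ∀ v : ℝ, 0 ≤ v → _ := fun t v hv =>
    ae_stays_iff (P := P) (Z := Z) (t := t) hγ hξ (ht₀.trans t.2.le)
      (fun s hs => hZ s (t.2.le.trans hs)) (s := v * t) (mul_nonneg hv (htpos t).le)
  have hfin : ∀ t : Set.Ioi t₀, ∀ᵐ ω ∂P, relocationTime (fun s => Z s ω) (t : ℝ) < ∞ := fun t =>
    ae_relocationTime_lt_top hd hγ hξ (ht₀.trans t.2.le) fun s hs => hZ s (t.2.le.trans hs)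
  have hup : ∀ t : Set.Ioi t₀,
      P {ω | w < (relocationTime (fun s => Z s ω) (t : ℝ)).toReal / (t : ℝ)} ≤
        P (stays ξ (slope γ t) (slope γ (t + w * t))) := fun t => by
    refine measure_mono_ae ?_
    filter_upwards [hiff t w hw, hfin t] with ω h1 h2 (h3 : w < _ / _)
    rw [lt_div_iff₀ (htpos t)] at h3
    exact h1.2 ((ENNReal.ofReal_lt_iff_lt_toReal (mul_nonneg hw (htpos t).le) h2.ne).2 h3)
  have hlow : ∀ v, w < v → ∀ t : Set.Ioi t₀,
      P (stays ξ (slope γ t) (slope γ (t + v * t))) ≤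
        P {ω | w < (relocationTime (fun s => Z s ω) (t : ℝ)).toReal / (t : ℝ)} := fun v hv t => by
    refine measure_mono_ae ?_
    filter_upwards [hiff t v (hw.trans hv.le), hfin t] with ω h1 h2 h3
    change w < _ / _
    refine hv.trans_le ?_
    rw [le_div_iff₀ (htpos t)]
    exact (ENNReal.ofReal_le_iff_le_toReal h2.ne).1 (h1.1 h3)
  refine tendsto_order.2 ⟨fun b hb => ?_, fun b hb => ?_⟩
  · have hcont := (continuous_stayProb_ratio (γ := γ) hd hγ).tendsto w
    obtain ⟨v, hv1, hv2⟩ := ((hcont.eventually_const_lt hb).filter_mono nhdsWithin_le_nhds).and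
      (self_mem_nhdsWithin (s := Set.Ioi w)) |>.exists
    filter_upwards [(hlim v (hw.trans (le_of_lt hv2))).eventually_const_lt hv1] with t ht
    exact ht.trans_le (hlow v hv2 t)
  · filter_upwards [(hlim w hw).eventually_lt_const hb] with t ht
    exact (hup t).trans_lt ht

theorem tendsto_measureReal_relocationTime_le (hd : 0 < d) (hγ : 0 < γ) (hξ : IsIIDWeibull P γ ξ)
    {t₀ : ℝ} (ht₀ : Real.exp (Real.exp 1) ≤ t₀)
    (hscal : ∀ w : ℝ, 0 ≤ w → Scaling d γ (1 / (1 + w)) (atTop : Filter (Set.Ioi t₀))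
      (fun t => spaceScale γ t) (fun t => slope γ t) (fun t => slope γ (t + w * t)))
    (hZ : ∀ s, t₀ ≤ s → ∀ ω, (∃ z, IsMaximiser γ (fun z' => ξ z' ω) s z) →
      IsMaximiser γ (fun z' => ξ z' ω) s (Z s ω)) (a : ℝ) :
    Tendsto (fun t : Set.Ioi t₀ =>
      P.real {ω | (relocationTime (fun s => Z s ω) (t : ℝ)).toReal / (t : ℝ) ≤ a}) atTop
      (𝓝 (limitCdf hd hγ a)) := by
  have htpos : ∀ t : Set.Ioi t₀, (0 : ℝ) < t := fun t => (Real.exp_pos _).trans_le (ht₀.trans t.2.le)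
  rcases lt_or_ge a 0 with ha | ha
  · rw [limitCdf_of_nonpos hd hγ ha.le]
    refine tendsto_const_nhds.congr fun t => ?_
    have : {ω | (relocationTime (fun s => Z s ω) (t : ℝ)).toReal / (t : ℝ) ≤ a} = ∅ := by
      refine Set.eq_empty_of_forall_notMem fun ω (hω : _ / _ ≤ a) => ?_
      have : 0 ≤ (relocationTime (fun s => Z s ω) (t : ℝ)).toReal / (t : ℝ) :=
        div_nonneg ENNReal.toReal_nonneg (htpos t).le
      linarith
    rw [this, measureReal_empty]
  · have h1 := (ENNReal.tendsto_toReal (stayProb_ratio_ne_top hd hγ a)).comp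
      (tendsto_measure_relocationTime_gt hd hγ hξ ht₀ hscal hZ ha)
    rw [limitCdf_apply]
    refine ((tendsto_const_nhds (x := (1 : ℝ))).sub h1).congr fun t => ?_
    have hmeas := (aemeasurable_relocationTime (P := P) (Z := Z) (t := t) hγ hξ (ht₀.trans t.2.le)
      fun s hs => hZ s (t.2.le.trans hs)).ennreal_toReal.div_const (t : ℝ)
    have hnull : NullMeasurableSet
        {ω | (relocationTime (fun s => Z s ω) (t : ℝ)).toReal / (t : ℝ) ≤ a} P :=
      hmeas.nullMeasurableSet_preimage measurableSet_Iic
    have hcompl : {ω | (relocationTime (fun s => Z s ω) (t : ℝ)).toReal / (t : ℝ) ≤ a}ᶜ =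
        {ω | a < (relocationTime (fun s => Z s ω) (t : ℝ)).toReal / (t : ℝ)} := by
      ext ω
      simp
    have h2 := probReal_compl_eq_one_sub₀ hnull
    rw [hcompl] at h2
    simp only [Function.comp]
    change 1 - P.real _ = _
    rw [h2]
    ring

end

end PAM

theorem theorem3 {Ω : Type*} [MeasurableSpace Ω] (P : Measure Ω) [IsProbabilityMeasure P]
    (d : ℕ) (hd : 0 < d) (γ : ℝ) (hγ : 0 < γ)
    (ξ : (Fin d → ℤ) → Ω → ℝ) (hξ : PAM.IsIIDWeibull P γ ξ)
    (Z : ℝ → Ω → (Fin d → ℤ))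
    (hZ : ∀ᶠ t in atTop, ∀ ω, (∃ z, PAM.IsMaximiser γ (fun z' => ξ z' ω) t z) →
      PAM.IsMaximiser γ (fun z' => ξ z' ω) t (Z t ω)) :
    -- almost surely, for all large `t` the maximiser exists, so that `Z t` is one
    (∀ᵐ ω ∂P, ∀ᶠ t in atTop, ∃ z, PAM.IsMaximiser γ (fun z' => ξ z' ω) t z) ∧
    -- for all large `t`, the relocation time is almost surely finite
    (∀ᶠ t in atTop, ∀ᵐ ω ∂P, PAM.relocationTime (fun s => Z s ω) t < ∞) ∧
    ∃ (Ω' : Type) (_ : MeasurableSpace Ω') (P' : Measure Ω') (_ : IsProbabilityMeasure P')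
      (Θ : Ω' → ℝ),
      Measurable Θ ∧
      -- `Θ` is nondegenerate and almost surely positive
      (¬ ∃ c : ℝ, ∀ᵐ ω' ∂P', Θ ω' = c) ∧
      (∀ᵐ ω' ∂P', 0 < Θ ω') ∧
      -- the distribution function of `Θ`
      (∀ w : ℝ, 0 ≤ w → PAM.ageingIntegral d γ w < ∞ ∧
        P'.real {ω' | Θ ω' ≤ w} = 1 - (PAM.ageingIntegral d γ w).toReal) ∧
      -- `T_t / t` converges weakly to `Θ` as `t → ∞`
      ∃ t₀ : ℝ, 0 < t₀ ∧ TendstoInDistribution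
        (fun (t : Set.Ioi t₀) (ω : Ω) =>
          (PAM.relocationTime (fun s => Z s ω) (t : ℝ)).toReal / (t : ℝ))
        atTop Θ (fun _ => P) P' := by
  obtain ⟨t₁, ht₁, hscal⟩ := PAM.exists_scaling hd hγ
  obtain ⟨t₂, ht₂⟩ := hZ.exists_forall_of_atTop
  set t₀ := max t₁ t₂ with ht₀
  have hexp : Real.exp (Real.exp 1) ≤ t₀ := ht₁.trans (le_max_left _ _)
  have hZ₀ : ∀ s, t₀ ≤ s → ∀ ω, (∃ z, PAM.IsMaximiser γ (fun z' => ξ z' ω) s z) →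
      PAM.IsMaximiser γ (fun z' => ξ z' ω) s (Z s ω) := fun s hs =>
    ht₂ s ((le_max_right _ _).trans hs)
  have hprob := PAM.isProbabilityMeasure_limitCdf (d := d) hd hγ
  have hcdf : ∀ w, (PAM.limitCdf hd hγ).measure.real {ω' | id ω' ≤ w} = PAM.limitCdf hd hγ w := by
    intro w
    have h1 := PAM.measure_Iic_limitCdf (γ := γ) hd hγ w
    change ((PAM.limitCdf hd hγ).measure (Set.Iic w)).toReal = _
    rw [h1, ENNReal.toReal_ofReal]
    -- Monotonicity and the limit zero at `-∞` make the distribution function nonnegative, so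
    -- `ENNReal.ofReal` does not truncate.
    exact le_of_tendsto (PAM.tendsto_limitCdf_atBot hd hγ)
      ((eventually_le_atBot w).mono fun v hv => (PAM.limitCdf hd hγ).mono hv)
  -- The variable `Θ` is the identity on `ℝ` under the law with distribution function `limitCdf`.
  -- Continuity of that function excludes a constant `Θ`, and its value zero at `0` gives
  -- positivity.
  refine ⟨?_, ?_, ℝ, inferInstance, (PAM.limitCdf hd hγ).measure, hprob, id, measurable_id, ?_, ?_,
    fun w hw => ?_, t₀, (Real.exp_pos _).trans_le hexp, ?_⟩
  · filter_upwards [PAM.ae_exists_isMaximiser hγ hξ] with ω hω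
    filter_upwards [eventually_ge_atTop t₀] with t ht
    exact hω t (PAM.slope_pos hγ (hexp.trans ht))
  · filter_upwards [eventually_ge_atTop t₀] with t ht
    exact PAM.ae_relocationTime_lt_top hd hγ hξ (hexp.trans ht) fun s hs => hZ₀ s (ht.trans hs)
  · rintro ⟨c, hc⟩
    have h1 : ∀ᵐ x ∂(PAM.limitCdf hd hγ).measure, x ≠ c :=
      compl_mem_ae_iff.2 (PAM.measure_singleton_limitCdf hd hγ c)
    obtain ⟨x, hx1, hx2⟩ := (hc.and h1).exists
    exact hx2 hx1
  · have h1 := PAM.measure_Iic_limitCdf (γ := γ) hd hγ 0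
    rw [PAM.limitCdf_of_nonpos hd hγ le_rfl, ENNReal.ofReal_zero] at h1
    filter_upwards [compl_mem_ae_iff.2 h1] with x hx
    exact not_le.1 hx
  · rw [PAM.ageingIntegral_eq_stayProb hd hγ hw, ← PAM.ratio_of_nonneg hw, hcdf]
    exact ⟨lt_top_iff_ne_top.2 (PAM.stayProb_ratio_ne_top hd hγ w), rfl⟩
  · refine PAM.tendstoInDistribution_of_tendsto_measure_le (fun t => ?_) aemeasurable_id fun a => ?_
    · exact (PAM.aemeasurable_relocationTime hγ hξ (hexp.trans t.2.le) fun s hs =>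
        hZ₀ s (t.2.le.trans hs)).ennreal_toReal.div_const _
    · rw [hcdf]
      exact PAM.tendsto_measureReal_relocationTime_le hd hγ hξ hexp
        (hscal t₀ (le_max_left _ _)) hZ₀ a
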